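/- **Setting.** Let $(H,\langle\cdot,\cdot\rangle_H,\|\cdot\|_H)$ be a separable real Hilbert space, $T\in(0,\infty)$, let $(\Omega,\mathcal F,\mathbb P)$ be a probability space with a normal filtration $(\mathbb F_t)_{t\in[0,T]}$ and an $\mathrm{Id}_H$-cylindrical $(\mathbb F_t)$-Wiener process $(W_t)_{t\in[0,T]}$. Let $\mathbb H\subseteq H$ be a non-empty orthonormal basis, let $\lambda\colon\mathbb H\to\mathbb R$ satisfy $\sup_{h\in\mathbb H}\lambda_h<0$, let $A\colon D(A)\subseteq H\to H$ be the diagonal operator $Av=\sum_{h\in\mathbb H}\lambda_h\langle h,v\rangle_H h$ with $D(A)=\{v\in H:\sum_h|\lambda_h\langle h,v\rangle_H|^2<\infty\}$, and let $H_r$, $r\in\mathbb R$, be the interpolation spaces associated to $-A$ (so that $\|v\|_{H_r}=\|(-A)^r v\|_H$). For $r\in\mathbb R$ let $\mathbf H_r=H_{r/2}\times H_{r/2-1/2}$ with the Hilbert product norm, let $\mathbf A\colon\mathbf H_1\subseteq\mathbf H_0\to\mathbf H_0$ be given by $\mathbf A(v,w)=(w,Av)$, and for $I\subseteq\mathbb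 H$ let $\mathbf P_I(v,w)=(P_Iv,P_Iw)$, where $P_I$ is the projection which keeps only the Fourier coefficients with index in $I$. Let $\mu\colon\mathbb H\to\mathbb R$ satisfy $\sum_{h\in\mathbb H}|\mu_h|^2/|\lambda_h|<\infty$, let $\mathbf B\in\mathrm{HS}(H,\mathbf H_0)$ be given by $\mathbf Bv=(0,\sum_{h\in\mathbb H}\mu_h\langle h,v\rangle_Hh)$, and for every $I\subseteq\mathbb H$ let $\mathbf X^I$ be an $\mathbf H_0$-valued random variable with $\mathbf X^I=\int_0^T e^{(T-s)\mathbf A}\,\mathbf P_I\mathbf B\,dW_s$ almost surely. **Statement.** Let $c,p\in(0,\infty)$, $\delta\in(-\infty,\tfrac12-\tfrac1{2p})$, let $e\colon\mathbb N=\{1,2,\dots\}\to\mathbb H$ be a bijection with $\lambda_{e_n}=-cn^p$ for all $n\in\mathbb N$, let $I_N=\{e_1,\dots,e_N\}$ for $N\in\mathbb N$, assume $|\mu_h|=|\lambda_h|^\delta$ for all $h\in\mathbb H$, and for $i\in\{1,2\}$ let $\varphi_i\colon\mathbf H_0\to\mathbb R$ be the function $\varphi_i(v_1,v_2)=\exp\bigl(-\|v_i\|^2_{H_{1/2-i/2}}\bigr)$.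 Then for all $i\in\{1,2\}$ and $N\in\mathbb N$ it holds that $\varphi_i\in C^2_{\mathrm b}(\mathbf H_0,\mathbb R)$ (bounded, twice continuously Fréchet differentiable, with bounded first and second derivatives) and $$\mathbb E[\varphi_i(\mathbf X^{I_N})]-\mathbb E[\varphi_i(\mathbf X^{\mathbb H})]\;\ge\;\Bigl[1+\inf_{x\in[2c^{1/2}T,\infty)}\frac{\sin(x)}{(-1)^i\,x}\Bigr]\,\frac{T\,c^{2\delta-1}\,2^{p(2\delta-1)}\,N^{p(2\delta-1)+1}}{[p(1-2\delta)-1]\,\exp\Bigl(\frac{6\,p(2\delta-1)\,T\,c^{2\delta-1}}{p(2\delta-1)+1}\Bigr)}\;>\;0 .$$ -/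

import Mathlib

open MeasureTheory ProbabilityTheory Filter Topology
open scoped ENNReal NNReal

namespace StochWave

/-! ## Stochastic analysis -/

/-- A normal filtration on `[0, T]`: it is right-continuous and its initial σ-algebra contains
all events of probability zero. -/
structure IsNormalFiltration {Ω : Type*} {mΩ : MeasurableSpace Ω} {T : ℝ}
    (F : Filtration (Set.Icc (0 : ℝ) T) mΩ) (hT : 0 < T) (P : Measure Ω) : Prop where
  rightContinuous : F.IsRightContinuous
  null_mem : ∀ s : Set Ω, MeasurableSet s → P s = 0 →
    MeasurableSet[F ⟨0, Set.left_mem_Icc.2 hT.le⟩] s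

/-- An `Id_H`-cylindrical Wiener process on `[0, T]` with respect to the filtration `F`. The random
variable `W t g` is `⟨g, W_t⟩_H`. -/
structure IsCylindricalWiener {Ω : Type*} {mΩ : MeasurableSpace Ω}
    {H : Type*} [NormedAddCommGroup H] [InnerProductSpace ℝ H] {T : ℝ}
    (F : Filtration (Set.Icc (0 : ℝ) T) mΩ) (hT : 0 < T) (P : Measure Ω)
    (W : Set.Icc (0 : ℝ) T → H → Ω → ℝ) : Prop where
  adapted : ∀ t g, Measurable[F t] (W t g)
  linear : ∀ t (a b : ℝ) (g k : H),
    ∀ᵐ ω ∂P, W t (a • g + b • k) ω = a * W t g ω + b * W t k ω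
  initial : ∀ g, ∀ᵐ ω ∂P, W ⟨0, Set.left_mem_Icc.2 hT.le⟩ g ω = 0
  gaussian_increments : ∀ s t, s ≤ t → ∀ g : H,
    HasLaw (fun ω => W t g ω - W s g ω)
      (gaussianReal 0 (Real.toNNReal (((t : ℝ) - (s : ℝ)) * ‖g‖ ^ 2))) P
  indep_increments : ∀ s t, s ≤ t →
    Indep (⨆ g : H, MeasurableSpace.comap (fun ω => W t g ω - W s g ω) inferInstance) (F s) P
  continuous_paths : ∀ g, ∀ᵐ ω ∂P, Continuous fun t => W t g ω

/-- A deterministic elementary operator-valued integrand on `[0, T]`, i.e. the step function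
`s ↦ ∑ k, 1_{(a k, b k]}(s) ⟨g k, ·⟩ u k` with values in the finite-rank operators. -/
structure Elementary (T : ℝ) (H U : Type*) where
  n : ℕ
  a : Fin n → Set.Icc (0 : ℝ) T
  b : Fin n → Set.Icc (0 : ℝ) T
  le : ∀ k, a k ≤ b k
  g : Fin n → H
  u : Fin n → U

section Integral

variable {T : ℝ} {H U : Type*} [NormedAddCommGroup H] [InnerProductSpace ℝ H]
  [NormedAddCommGroup U] [InnerProductSpace ℝ U]

/-- The operator-valued step function given by the elementary integrand `E`. -/
noncomputable def Elementary.toFun (E : Elementary T H U) (s : ℝ) : H →L[ℝ] U :=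
  ∑ k, (Set.Ioc (E.a k : ℝ) (E.b k : ℝ)).indicator
    (fun _ => (innerSL ℝ (E.g k)).smulRight (E.u k)) s

/-- The stochastic integral of an elementary integrand. -/
noncomputable def Elementary.integral {Ω : Type*} (E : Elementary T H U)
    (W : Set.Icc (0 : ℝ) T → H → Ω → ℝ) (ω : Ω) : U :=
  ∑ k, (W (E.b k) (E.g k) ω - W (E.a k) (E.g k) ω) • E.u k

/-- The square of the Hilbert–Schmidt norm (it does not depend on the orthonormal basis `e`). -/
noncomputable def hsNormSq {ι : Type*} (e : HilbertBasis ι ℝ H) (L : H →L[ℝ] U) : ℝ≥0∞ :=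
  ∑' i, ‖L (e i)‖ₑ ^ 2

/-- `X = ∫_0^T Φ(s) dW_s` almost surely, for the deterministic integrand `Φ`: the random variable
`X` is the limit in `L²(P; U)` of the integrals of elementary integrands which converge to `Φ`
in `L²([0, T]; HS(H, U))`. -/
def IsWienerIntegral {Ω : Type*} {mΩ : MeasurableSpace Ω} (P : Measure Ω) {ι : Type*}
    (e : HilbertBasis ι ℝ H) (W : Set.Icc (0 : ℝ) T → H → Ω → ℝ)
    (Φ : ℝ → H →L[ℝ] U) (X : Ω → U) : Prop :=
  (∀ g : H, AEStronglyMeasurable (fun s => Φ s g) (volume.restrict (Set.Icc 0 T))) ∧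
  AEStronglyMeasurable X P ∧
  ∃ E : ℕ → Elementary T H U,
    Tendsto (fun n => ∫⁻ s in Set.Icc 0 T, hsNormSq e ((E n).toFun s - Φ s)) atTop (𝓝 0) ∧
    Tendsto (fun n => ∫⁻ ω, ‖(E n).integral W ω - X ω‖ₑ ^ 2 ∂P) atTop (𝓝 0)

end Integral

/-! ## Function classes and semigroups -/

/-- The class `C²_b(V, W)` of bounded `C²` functions with bounded first and second derivatives. -/
def IsC2b {V W : Type*} [NormedAddCommGroup V] [NormedSpace ℝ V]
    [NormedAddCommGroup W] [NormedSpace ℝ W] (f : V → W) : Prop :=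
  ContDiff ℝ 2 f ∧
    ∃ C : ℝ, ∀ x, ‖f x‖ ≤ C ∧ ‖fderiv ℝ f x‖ ≤ C ∧ ‖fderiv ℝ (fderiv ℝ f) x‖ ≤ C

/-- `(S t)_{t ≥ 0}` is a strongly continuous semigroup with generator `A`, i.e. `S t = e^{tA}`. -/
structure IsSemigroupGeneratedBy {V : Type*} [NormedAddCommGroup V] [NormedSpace ℝ V]
    (S : ℝ → V →L[ℝ] V) (A : V →ₗ.[ℝ] V) : Prop where
  zero : S 0 = ContinuousLinearMap.id ℝ V
  add : ∀ s t, 0 ≤ s → 0 ≤ t → S (s + t) = (S s).comp (S t)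
  strong : ∀ x, Tendsto (fun t => S t x) (𝓝[>] 0) (𝓝 x)
  generator : ∀ x y, (x, y) ∈ A.graph ↔
    Tendsto (fun t : ℝ => t⁻¹ • (S t x - x)) (𝓝[>] 0) (𝓝 y)

/-! ## The linear wave equation in spectral coordinates

The orthonormal basis of `H` is indexed by `ι`, and vectors are described by their families of
Fourier coefficients with respect to it. In these coordinates the operator `A` is multiplication by
`lam`. -/

/-- The eigenvalues `lam` of `A` and the noise coefficients `mu`. -/
structure WaveData (ι : Type*) where
  lam : ι → ℝ
  mu : ι → ℝ
  nonempty : Nonempty ι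
  iSup_lam_neg : ⨆ h, lam h < 0
  summable_noise : Summable fun h => |mu h| ^ 2 / |lam h|

section Spaces

variable {ι : Type*} (D : WaveData ι) (r : ℝ)

theorem WaveData.lam_neg (h : ι) : D.lam h < 0 := by
  by_cases hb : BddAbove (Set.range D.lam)
  · exact (le_ciSup hb h).trans_lt D.iSup_lam_neg
  · have := D.iSup_lam_neg
    rw [Real.iSup_of_not_bddAbove hb] at this
    exact absurd this (lt_irrefl _)

theorem WaveData.abs_lam_pos (h : ι) : 0 < |D.lam h| := abs_pos.2 (D.lam_neg h).ne

/-- The coefficient families `x` with `∑ h, (|lam h|^r x h)^2 < ∞`. -/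
def interpSubmodule : Submodule ℝ (ι → ℝ) where
  carrier := {x | Summable fun h => (|D.lam h| ^ r * x h) ^ 2}
  zero_mem' := by simp
  add_mem' {x y} hx hy := by
    refine Summable.of_nonneg_of_le (fun h => sq_nonneg _) (fun h => ?_)
      ((hx.mul_left 2).add (hy.mul_left 2))
    simp only [Pi.add_apply]
    nlinarith [sq_nonneg (|D.lam h| ^ r * x h - |D.lam h| ^ r * y h)]
  smul_mem' c x hx := by
    refine (hx.mul_left (c ^ 2)).congr fun h => ?_
    simp only [Pi.smul_apply, smul_eq_mul]
    ring

theorem memℓp_two_iff {ι : Type*} (f : ι → ℝ) :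
    Memℓp f 2 ↔ Summable fun h => f h ^ 2 := by
  rw [memℓp_gen_iff (by norm_num)]
  simp

/-- The interpolation space `H_r` associated to `-A`. The coefficient family `x` stands for the
vector `∑ h, x h • h`, and its norm is `‖(-A)^r x‖_H`. For `r ≥ 0` this is the domain of `(-A)^r`;
for `r < 0` it is the completion of `H` with respect to `‖(-A)^r ·‖_H`. -/
def InterpSpace : Type _ := interpSubmodule D r

noncomputable instance : AddCommGroup (InterpSpace D r) :=
  inferInstanceAs (AddCommGroup (interpSubmodule D r))

noncomputable instance : Module ℝ (InterpSpace D r) :=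
  inferInstanceAs (Module ℝ (interpSubmodule D r))

/-- The coefficient family of an element of `H_r`. -/
def coeff : InterpSpace D r →ₗ[ℝ] (ι → ℝ) := (interpSubmodule D r).subtype

variable {D r} in
theorem coeff_injective : Function.Injective (coeff D r) := Subtype.coe_injective

variable {D r} in
theorem coeff_mem (x : InterpSpace D r) : coeff D r x ∈ interpSubmodule D r := Subtype.coe_prop x

/-- `(-A)^r` as a bijection from `H_r` to `ℓ²`. -/
noncomputable def toL2 : InterpSpace D r ≃ₗ[ℝ] lp (fun _ : ι => ℝ) 2 where
  toFun x := ⟨fun h => |D.lam h| ^ r * coeff D r x h, (memℓp_two_iff _).2 (coeff_mem x)⟩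
  map_add' x y := by
    ext h
    rw [lp.coeFn_add]
    simp [mul_add]
  map_smul' c x := by ext h; simp; ring
  invFun y := ⟨fun h => |D.lam h| ^ (-r) * y h, by
    refine ((memℓp_two_iff _).1 (lp.memℓp y)).congr fun h => ?_
    rw [← mul_assoc, ← Real.rpow_add (D.abs_lam_pos h)]
    simp⟩
  left_inv x := by
    apply coeff_injective
    funext h
    change |D.lam h| ^ (-r) * (|D.lam h| ^ r * coeff D r x h) = _
    rw [← mul_assoc, ← Real.rpow_add (D.abs_lam_pos h)]
    simp
  right_inv y := by
    ext h
    change |D.lam h| ^ r * (|D.lam h| ^ (-r) * y h) = _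
    rw [← mul_assoc, ← Real.rpow_add (D.abs_lam_pos h)]
    simp

noncomputable instance : NormedAddCommGroup (InterpSpace D r) :=
  NormedAddCommGroup.induced _ (lp (fun _ : ι => ℝ) 2) (toL2 D r) (toL2 D r).injective

noncomputable instance : NormedSpace ℝ (InterpSpace D r) :=
  NormedSpace.induced ℝ _ (lp (fun _ : ι => ℝ) 2) (toL2 D r)

noncomputable instance : InnerProductSpace ℝ (InterpSpace D r) where
  inner x y := inner ℝ (toL2 D r x) (toL2 D r y)
  norm_sq_eq_re_inner x := norm_sq_eq_re_inner (𝕜 := ℝ) (toL2 D r x)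
  conj_inner_symm x y := inner_conj_symm (𝕜 := ℝ) (toL2 D r x) (toL2 D r y)
  add_left x y z := by rw [map_add, inner_add_left]
  smul_left x y c := by rw [map_smul, inner_smul_left]

/-- `toL2` as an isometry. -/
noncomputable def toL2ᵢ : InterpSpace D r ≃ₗᵢ[ℝ] lp (fun _ : ι => ℝ) 2 where
  toLinearEquiv := toL2 D r
  norm_map' _ := rfl

instance : CompleteSpace (InterpSpace D r) :=
  (toL2ᵢ D r).toIsometryEquiv.completeSpace

theorem norm_sq_interp (x : InterpSpace D r) :
    ‖x‖ ^ 2 = ∑' h, (|D.lam h| ^ r * coeff D r x h) ^ 2 := by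
  have h1 : ‖x‖ = ‖toL2 D r x‖ := rfl
  have h2 := lp.norm_rpow_eq_tsum (p := 2) (by norm_num) (toL2 D r x)
  have h3 : ∀ h, (toL2 D r x) h = |D.lam h| ^ r * coeff D r x h := fun _ => rfl
  rw [h1]
  simp only [ENNReal.toReal_ofNat, Real.rpow_ofNat, h3, Real.norm_eq_abs, sq_abs] at h2
  exact h2

/-- The isometric identification of `H` with `H_0`. -/
noncomputable def embed {H : Type*} [NormedAddCommGroup H] [InnerProductSpace ℝ H]
    (e : HilbertBasis ι ℝ H) : H ≃ₗᵢ[ℝ] InterpSpace D 0 :=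
  e.repr.trans (toL2ᵢ D 0).symm

/-- The Hilbert space `𝐇_r = H_{r/2} × H_{r/2 - 1/2}` (with the Hilbert product norm). -/
abbrev BoldH : Type _ := WithLp 2 (InterpSpace D (r / 2) × InterpSpace D (r / 2 - 1 / 2))

variable {D} in
theorem diag_bound {r q : ℝ} {m : ι → ℝ} {C : ℝ}
    (hC : ∀ h, |D.lam h| ^ q * |m h| ≤ C * |D.lam h| ^ r) (x : ι → ℝ) (h : ι) :
    (|D.lam h| ^ q * (m h * x h)) ^ 2 ≤ C ^ 2 * (|D.lam h| ^ r * x h) ^ 2 := by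
  have h0 : 0 ≤ |D.lam h| ^ q * |m h| := by positivity
  have h1 : (|D.lam h| ^ q * |m h|) ^ 2 ≤ (C * |D.lam h| ^ r) ^ 2 :=
    pow_le_pow_left₀ h0 (hC h) 2
  have h2 := mul_le_mul_of_nonneg_right h1 (sq_nonneg (x h))
  calc (|D.lam h| ^ q * (m h * x h)) ^ 2 = (|D.lam h| ^ q * |m h|) ^ 2 * (x h) ^ 2 := by
        rw [mul_pow _ |m h|, sq_abs]; ring
    _ ≤ _ := h2
    _ = _ := by ring

variable {D} in
/-- The diagonal operator which multiplies the coefficients by `m`, as a bounded operator from `H_r`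
to `H_q`. -/
noncomputable def diag (r q : ℝ) (m : ι → ℝ)
    (hm : ∃ C, ∀ h, |D.lam h| ^ q * |m h| ≤ C * |D.lam h| ^ r) :
    InterpSpace D r →L[ℝ] InterpSpace D q :=
  LinearMap.mkContinuousOfExistsBound (σ := RingHom.id ℝ)
    { toFun := fun x => ⟨fun h => m h * coeff D r x h, by
        obtain ⟨C, hC⟩ := hm
        exact Summable.of_nonneg_of_le (fun h => sq_nonneg _) (fun h => diag_bound hC _ h)
          ((coeff_mem x).mul_left (C ^ 2))⟩
      map_add' := fun x y => coeff_injective (funext fun h => by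
        change m h * coeff D r (x + y) h = m h * coeff D r x h + m h * coeff D r y h
        rw [map_add, Pi.add_apply, mul_add])
      map_smul' := fun c x => coeff_injective (funext fun h => by
        change m h * coeff D r (c • x) h = c * (m h * coeff D r x h)
        rw [map_smul, Pi.smul_apply, smul_eq_mul]
        ring) }
    (by
      obtain ⟨C, hC⟩ := hm
      refine ⟨|C|, fun x => ?_⟩
      refine le_of_sq_le_sq ?_ (by positivity)
      rw [mul_pow, sq_abs, norm_sq_interp, norm_sq_interp, ← tsum_mul_left]
      exact Summable.tsum_le_tsum (fun h => diag_bound hC _ h)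
        (Summable.of_nonneg_of_le (fun h => sq_nonneg _) (fun h => diag_bound hC _ h)
          ((coeff_mem x).mul_left (C ^ 2))) ((coeff_mem x).mul_left (C ^ 2)))

variable {D} in
@[simp] theorem coeff_diag (r q : ℝ) (m : ι → ℝ)
    (hm : ∃ C, ∀ h, |D.lam h| ^ q * |m h| ≤ C * |D.lam h| ^ r) (x : InterpSpace D r) (h : ι) :
    coeff D q (diag r q m hm x) h = m h * coeff D r x h := rfl

variable {D} in
/-- Embedding of a pair of vectors into the product space. -/
noncomputable def pairL {V : Type*} [NormedAddCommGroup V] [NormedSpace ℝ V]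
    (f : V →L[ℝ] InterpSpace D (r / 2)) (g : V →L[ℝ] InterpSpace D (r / 2 - 1 / 2)) :
    V →L[ℝ] BoldH D r :=
  ((WithLp.prodContinuousLinearEquiv 2 ℝ (InterpSpace D (r / 2))
    (InterpSpace D (r / 2 - 1 / 2))).symm : _ →L[ℝ] _).comp (f.prod g)

open scoped Classical in
/-- The orthogonal projection `P_I` on `H_r`, which keeps the coefficients with index in `I`. -/
noncomputable def proj (I : Set ι) : InterpSpace D r →L[ℝ] InterpSpace D r :=
  diag r r (fun h => if h ∈ I then 1 else 0) ⟨1, fun h => by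
    have : 0 ≤ |D.lam h| ^ r := by positivity
    split_ifs <;> simp [this]⟩

/-- The projection `𝐏_I (v, w) = (P_I v, P_I w)` on `𝐇_r`. -/
noncomputable def boldP (I : Set ι) : BoldH D r →L[ℝ] BoldH D r :=
  pairL r ((proj D (r / 2) I).comp (WithLp.fstL 2 ℝ _ _))
    ((proj D (r / 2 - 1 / 2) I).comp (WithLp.sndL 2 ℝ _ _))

theorem noise_bound :
    ∃ C, ∀ h, |D.lam h| ^ ((0 : ℝ) / 2 - 1 / 2) * |D.mu h| ≤ C * |D.lam h| ^ (0 : ℝ) := by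
  refine ⟨√(∑' h, |D.mu h| ^ 2 / |D.lam h|), fun h => ?_⟩
  rw [Real.rpow_zero, mul_one]
  apply Real.le_sqrt_of_sq_le
  have h1 := D.summable_noise.le_tsum h (fun j _ => by positivity)
  refine le_trans (le_of_eq ?_) h1
  rw [mul_pow, ← Real.rpow_natCast, ← Real.rpow_mul (abs_nonneg _)]
  norm_num [Real.rpow_neg_one]
  field_simp

/-- The noise operator `𝐁 v = (0, ∑ h, mu h ⟨h, v⟩ h)` from `H` to `𝐇_0`. -/
noncomputable def boldB {H : Type*} [NormedAddCommGroup H] [InnerProductSpace ℝ H]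
    (e : HilbertBasis ι ℝ H) : H →L[ℝ] BoldH D 0 :=
  pairL 0 0 ((diag 0 (0 / 2 - 1 / 2) D.mu (noise_bound D)).comp
    ((embed D e).toContinuousLinearEquiv : H →L[ℝ] InterpSpace D 0))

variable {D} in
theorem boldH_ext {x y : BoldH D r}
    (h1 : ∀ h, coeff D _ x.fst h = coeff D _ y.fst h)
    (h2 : ∀ h, coeff D _ x.snd h = coeff D _ y.snd h) : x = y := by
  have e1 : x.fst = y.fst := coeff_injective (funext h1)
  have e2 : x.snd = y.snd := coeff_injective (funext h2)
  exact (WithLp.ofLp_injective 2) (Prod.ext e1 e2)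

theorem coeff_boldP (I : Set ι) [DecidablePred (· ∈ I)] (x : BoldH D r) (h : ι) :
    coeff D _ (boldP D r I x).fst h = (if h ∈ I then coeff D _ x.fst h else 0) ∧
    coeff D _ (boldP D r I x).snd h = (if h ∈ I then coeff D _ x.snd h else 0) := by
  constructor
  · change (@ite ℝ (h ∈ I) (Classical.propDecidable _) 1 0) * coeff D _ x.fst h = _
    split_ifs <;> simp
  · change (@ite ℝ (h ∈ I) (Classical.propDecidable _) 1 0) * coeff D _ x.snd h = _
    split_ifs <;> simp

theorem coeff_embed {H : Type*} [NormedAddCommGroup H] [InnerProductSpace ℝ H]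
    (e : HilbertBasis ι ℝ H) (v : H) (h : ι) : coeff D 0 (embed D e v) h = inner ℝ (e h) v := by
  change |D.lam h| ^ (-(0 : ℝ)) * e.repr v h = _
  rw [neg_zero, Real.rpow_zero, one_mul, e.repr_apply_apply]

theorem coeff_boldB {H : Type*} [NormedAddCommGroup H] [InnerProductSpace ℝ H]
    (e : HilbertBasis ι ℝ H) (v : H) (h : ι) :
    coeff D _ (boldB D e v).fst h = 0 ∧
    coeff D _ (boldB D e v).snd h = D.mu h * inner ℝ (e h) v :=
  ⟨rfl, by rw [← coeff_embed D]; rfl⟩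

theorem mem_interp_zero_iff {x : ι → ℝ} :
    x ∈ interpSubmodule D (1 / 2 - 1 / 2) ↔ x ∈ interpSubmodule D (0 / 2) := by
  rw [sub_self, zero_div]

theorem lam_mem {x : ι → ℝ} (hx : x ∈ interpSubmodule D (1 / 2)) :
    (fun h => D.lam h * x h) ∈ interpSubmodule D (0 / 2 - 1 / 2) := by
  refine Summable.congr (f := fun h => (|D.lam h| ^ (1 / 2 : ℝ) * x h) ^ 2) hx fun h => ?_
  have h1 : |D.lam h| ^ ((1 : ℝ) / 2) = |D.lam h| ^ ((0 : ℝ) / 2 - 1 / 2) * |D.lam h| := by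
    rw [← Real.rpow_add_one (D.abs_lam_pos h).ne']
    norm_num
  rw [h1, mul_pow, mul_pow, mul_pow, mul_pow, sq_abs]
  ring

/-- The wave operator `𝐀 (v, w) = (w, A v)` on `𝐇_0`, with domain `𝐇_1 = H_{1/2} × H_0`. -/
noncomputable def boldA : BoldH D 0 →ₗ.[ℝ] BoldH D 0 where
  domain :=
    (interpSubmodule D (1 / 2)).comap (coeff D (0 / 2) ∘ₗ WithLp.fstₗ 2 ℝ _ _) ⊓
    (interpSubmodule D (1 / 2 - 1 / 2)).comap (coeff D (0 / 2 - 1 / 2) ∘ₗ WithLp.sndₗ 2 ℝ _ _)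
  toFun :=
    { toFun := fun x => WithLp.toLp 2
        (⟨coeff D _ x.1.snd, by
            exact (mem_interp_zero_iff D).1 x.2.2⟩,
          ⟨fun h => D.lam h * coeff D _ x.1.fst h, lam_mem D x.2.1⟩)
      map_add' := fun x y => by
        apply boldH_ext
        · intro h
          rfl
        · intro h
          exact mul_add _ _ _
      map_smul' := fun c x => by
        apply boldH_ext
        · intro h
          rfl
        · intro h
          exact mul_left_comm _ _ _ }

theorem cos_bound (r t : ℝ) : ∃ C, ∀ h,
    |D.lam h| ^ r * |Real.cos (|D.lam h| ^ (1 / 2 : ℝ) * t)| ≤ C * |D.lam h| ^ r :=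
  ⟨1, fun h => by
    rw [one_mul]
    exact mul_le_of_le_one_right (by positivity) (Real.abs_cos_le_one _)⟩

theorem sin_bound₁ (t : ℝ) : ∃ C, ∀ h, |D.lam h| ^ ((0 : ℝ) / 2) *
    |Real.sin (|D.lam h| ^ (1 / 2 : ℝ) * t) / |D.lam h| ^ (1 / 2 : ℝ)| ≤
      C * |D.lam h| ^ ((0 : ℝ) / 2 - 1 / 2) :=
  ⟨1, fun h => by
    have h0 := D.abs_lam_pos h
    have h1 : 0 < |D.lam h| ^ (1 / 2 : ℝ) := by positivity
    rw [abs_div, abs_of_pos h1, zero_div, Real.rpow_zero, Real.rpow_sub h0, Real.rpow_zero]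
    simp only [one_mul]
    gcongr
    exact Real.abs_sin_le_one _⟩

theorem sin_bound₂ (t : ℝ) : ∃ C, ∀ h, |D.lam h| ^ ((0 : ℝ) / 2 - 1 / 2) *
    |-(|D.lam h| ^ (1 / 2 : ℝ) * Real.sin (|D.lam h| ^ (1 / 2 : ℝ) * t))| ≤
      C * |D.lam h| ^ ((0 : ℝ) / 2) :=
  ⟨1, fun h => by
    have h0 := D.abs_lam_pos h
    have h1 : 0 < |D.lam h| ^ (1 / 2 : ℝ) := by positivity
    rw [abs_neg, abs_mul, abs_of_pos h1, zero_div, Real.rpow_zero, Real.rpow_sub h0,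
      Real.rpow_zero, ← mul_assoc, one_div_mul_cancel h1.ne']
    simpa using Real.abs_sin_le_one _⟩

/-- The operators `e^{t𝐀}`, `t ∈ ℝ`, on `𝐇_0`, given by the matrix
`[[cos((-A)^{1/2} t), (-A)^{-1/2} sin((-A)^{1/2} t)],
  [-(-A)^{1/2} sin((-A)^{1/2} t), cos((-A)^{1/2} t)]]`.
The theorem `waveGroup_isSemigroupGeneratedBy` below shows that this is the strongly continuous
semigroup generated by `𝐀`. -/
noncomputable def waveGroup (t : ℝ) : BoldH D 0 →L[ℝ] BoldH D 0 :=
  pairL 0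
    ((diag (0 / 2) (0 / 2) (fun h => Real.cos (|D.lam h| ^ (1 / 2 : ℝ) * t))
        (cos_bound D _ t)).comp (WithLp.fstL 2 ℝ _ _) +
      (diag (0 / 2 - 1 / 2) (0 / 2)
        (fun h => Real.sin (|D.lam h| ^ (1 / 2 : ℝ) * t) / |D.lam h| ^ (1 / 2 : ℝ))
        (sin_bound₁ D t)).comp (WithLp.sndL 2 ℝ _ _))
    ((diag (0 / 2) (0 / 2 - 1 / 2)
        (fun h => -(|D.lam h| ^ (1 / 2 : ℝ) * Real.sin (|D.lam h| ^ (1 / 2 : ℝ) * t)))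
        (sin_bound₂ D t)).comp (WithLp.fstL 2 ℝ _ _) +
      (diag (0 / 2 - 1 / 2) (0 / 2 - 1 / 2) (fun h => Real.cos (|D.lam h| ^ (1 / 2 : ℝ) * t))
        (cos_bound D _ t)).comp (WithLp.sndL 2 ℝ _ _))

@[simp] theorem coeff_waveGroup_fst (t : ℝ) (x : BoldH D 0) (h : ι) :
    coeff D _ (waveGroup D t x).fst h =
      Real.cos (|D.lam h| ^ (1 / 2 : ℝ) * t) * coeff D _ x.fst h +
      Real.sin (|D.lam h| ^ (1 / 2 : ℝ) * t) / |D.lam h| ^ (1 / 2 : ℝ) * coeff D _ x.snd h := rfl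

@[simp] theorem coeff_waveGroup_snd (t : ℝ) (x : BoldH D 0) (h : ι) :
    coeff D _ (waveGroup D t x).snd h =
      -(|D.lam h| ^ (1 / 2 : ℝ) * Real.sin (|D.lam h| ^ (1 / 2 : ℝ) * t)) * coeff D _ x.fst h +
      Real.cos (|D.lam h| ^ (1 / 2 : ℝ) * t) * coeff D _ x.snd h := rfl

variable {D} in
theorem tendsto_interp {r : ℝ} {l : Filter ℝ} (F : ℝ → InterpSpace D r) (a : InterpSpace D r)
    (g : ι → ℝ) (hg : Summable fun h => g h ^ 2)
    (hF : ∀ᶠ t in l, ∀ h, |(|D.lam h| ^ r * coeff D r (F t) h)| ≤ g h)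
    (ha : ∀ h, |(|D.lam h| ^ r * coeff D r a h)| ≤ g h)
    (hlim : ∀ h, Tendsto (fun t => coeff D r (F t) h) l (𝓝 (coeff D r a h))) :
    Tendsto F l (𝓝 a) := by
  rw [tendsto_iff_norm_sub_tendsto_zero]
  have key : Tendsto (fun t => ‖F t - a‖ ^ 2) l (𝓝 0) := by
    simp_rw [norm_sq_interp]
    have := tendsto_tsum_of_dominated_convergence (𝓕 := l)
      (f := fun t h => (|D.lam h| ^ r * coeff D r (F t - a) h) ^ 2) (g := fun _ => 0)
      (bound := fun h => 4 * g h ^ 2) (hg.mul_left 4) ?_ ?_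
    · simpa using this
    · intro h
      have h1 := (((hlim h).sub_const (coeff D r a h)).const_mul (|D.lam h| ^ r)).pow 2
      simpa using h1
    · filter_upwards [hF] with t ht h
      have h1 := abs_le.1 (ht h)
      have h2 := abs_le.1 (ha h)
      have h3 : |D.lam h| ^ r * coeff D r (F t - a) h =
          |D.lam h| ^ r * coeff D r (F t) h - |D.lam h| ^ r * coeff D r a h := by
        simp [mul_sub]
      rw [Real.norm_eq_abs, abs_of_nonneg (sq_nonneg _), h3]
      nlinarith [h1.1, h1.2, h2.1, h2.2]
  have := key.sqrt
  simpa using this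

variable {D} in
theorem tendsto_boldH {r : ℝ} {l : Filter ℝ} {F : ℝ → BoldH D r} {a : BoldH D r} :
    Tendsto F l (𝓝 a) ↔
      Tendsto (fun t => (F t).fst) l (𝓝 a.fst) ∧ Tendsto (fun t => (F t).snd) l (𝓝 a.snd) := by
  refine ⟨fun h => ⟨((WithLp.fstL 2 ℝ _ _).continuous.tendsto a).comp h,
    ((WithLp.sndL 2 ℝ _ _).continuous.tendsto a).comp h⟩, fun h => ?_⟩
  exact ((WithLp.prodContinuousLinearEquiv 2 ℝ (InterpSpace D (r / 2))
    (InterpSpace D (r / 2 - 1 / 2))).symm.continuous.tendsto (a.fst, a.snd)).comp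
      (h.1.prodMk_nhds h.2)

variable {D} in
theorem tendsto_coeff {r : ℝ} {l : Filter ℝ} {F : ℝ → InterpSpace D r} {a : InterpSpace D r}
    (hF : Tendsto F l (𝓝 a)) (h : ι) :
    Tendsto (fun t => coeff D r (F t) h) l (𝓝 (coeff D r a h)) := by
  rw [tendsto_iff_norm_sub_tendsto_zero] at hF ⊢
  have hp : 0 < |D.lam h| ^ r := Real.rpow_pos_of_pos (D.abs_lam_pos h) r
  refine squeeze_zero (fun t => norm_nonneg _) (fun t => ?_)
    (by simpa using hF.const_mul (|D.lam h| ^ r)⁻¹)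
  rw [le_inv_mul_iff₀ hp]
  apply le_of_sq_le_sq _ (norm_nonneg _)
  rw [norm_sq_interp]
  refine le_trans (le_of_eq ?_) ((coeff_mem (F t - a)).le_tsum h fun _ _ => sq_nonneg _)
  simp [mul_pow]

theorem freq_sq (h : ι) :
    |D.lam h| ^ (1 / 2 : ℝ) * |D.lam h| ^ (1 / 2 : ℝ) = -D.lam h := by
  rw [← Real.rpow_add (D.abs_lam_pos h), abs_of_neg (D.lam_neg h)]
  norm_num

theorem freq_pos (h : ι) : 0 < |D.lam h| ^ (1 / 2 : ℝ) :=
  Real.rpow_pos_of_pos (D.abs_lam_pos h) _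

theorem tendsto_slope_fst (x : BoldH D 0) (h : ι) :
    Tendsto (fun t : ℝ => coeff D _ (t⁻¹ • (waveGroup D t x - x)).fst h) (𝓝[>] 0)
      (𝓝 (coeff D _ x.snd h)) := by
  have hω := freq_pos D h
  set ω := |D.lam h| ^ (1 / 2 : ℝ) with hωdef
  set v := coeff D _ x.fst h
  set w := coeff D _ x.snd h
  have hid : HasDerivAt (fun t : ℝ => ω * t) ω 0 := by
    simpa using (hasDerivAt_id (0 : ℝ)).const_mul ω
  have hd : HasDerivAt (fun t : ℝ => Real.cos (ω * t) * v + Real.sin (ω * t) / ω * w) w 0 := by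
    refine ((hid.cos.mul_const v).add ((hid.sin.div_const ω).mul_const w)).congr_deriv ?_
    simp [hω.ne']
  have := hd.tendsto_slope_zero_right
  refine this.congr fun t => ?_
  simp only [zero_add, mul_zero, Real.cos_zero, Real.sin_zero, zero_div, zero_mul, one_mul,
    add_zero]
  rfl

theorem tendsto_slope_snd (x : BoldH D 0) (h : ι) :
    Tendsto (fun t : ℝ => coeff D _ (t⁻¹ • (waveGroup D t x - x)).snd h) (𝓝[>] 0)
      (𝓝 (D.lam h * coeff D _ x.fst h)) := by
  have hsq := freq_sq D h
  set ω := |D.lam h| ^ (1 / 2 : ℝ) with hωdef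
  set v := coeff D _ x.fst h
  set w := coeff D _ x.snd h
  have hid : HasDerivAt (fun t : ℝ => ω * t) ω 0 := by
    simpa using (hasDerivAt_id (0 : ℝ)).const_mul ω
  have hd : HasDerivAt (fun t : ℝ => -(ω * Real.sin (ω * t)) * v + Real.cos (ω * t) * w)
      (D.lam h * v) 0 := by
    refine (((hid.sin.const_mul ω).neg.mul_const v).add (hid.cos.mul_const w)).congr_deriv ?_
    simp [hsq]
  have := hd.tendsto_slope_zero_right
  refine this.congr fun t => ?_
  simp only [zero_add, mul_zero, Real.cos_zero, Real.sin_zero, neg_zero, zero_mul, one_mul]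
  rfl

/-- `waveGroup D` is the strongly continuous semigroup generated by `boldA D`. -/
theorem waveGroup_isSemigroupGeneratedBy : IsSemigroupGeneratedBy (waveGroup D) (boldA D) where
  zero := by
    ext1 x
    apply boldH_ext <;> intro h <;> simp
  add s t _ _ := by
    ext1 x
    apply boldH_ext <;> intro h <;>
      simp only [ContinuousLinearMap.comp_apply, coeff_waveGroup_fst, coeff_waveGroup_snd, mul_add,
        Real.cos_add, Real.sin_add] <;>
      have := (freq_pos D h).ne' <;> field_simp <;> ring
  strong x := by
    have hm1 := coeff_mem x.fst
    have hm2 := coeff_mem x.snd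
    have hω := freq_pos D
    have hw : ∀ h, |D.lam h| ^ ((0 : ℝ) / 2 - 1 / 2) = (|D.lam h| ^ (1 / 2 : ℝ))⁻¹ := fun h => by
      rw [← Real.rpow_neg (abs_nonneg _)]
      norm_num
    have hw0 : ∀ h, |D.lam h| ^ ((0 : ℝ) / 2) = 1 := fun h => by simp
    have hg : Summable fun h => (|coeff D _ x.fst h| +
        |(|D.lam h| ^ (1 / 2 : ℝ))⁻¹ * coeff D _ x.snd h|) ^ 2 := by
      refine Summable.of_nonneg_of_le (fun h => sq_nonneg _) (fun h => ?_)
        ((hm1.mul_left 2).add (hm2.mul_left 2))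
      rw [hw, hw0, one_mul, ← sq_abs (coeff D _ x.fst h), ← sq_abs ((|D.lam h| ^ (1 / 2 : ℝ))⁻¹ * _)]
      nlinarith [sq_nonneg (|coeff D _ x.fst h| -
        |(|D.lam h| ^ (1 / 2 : ℝ))⁻¹ * coeff D _ x.snd h|)]
    rw [tendsto_boldH]
    constructor
    · refine tendsto_interp _ _ _ hg (Eventually.of_forall fun t h => ?_) (fun h => ?_) fun h => ?_
      · rw [hw0, one_mul, coeff_waveGroup_fst]
        refine (abs_add_le _ _).trans ?_
        rw [abs_mul, div_mul_eq_mul_div, mul_div_assoc, abs_mul,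
          div_eq_inv_mul (coeff D _ x.snd h)]
        exact add_le_add (mul_le_of_le_one_left (abs_nonneg _) (Real.abs_cos_le_one _))
          (mul_le_of_le_one_left (abs_nonneg _) (Real.abs_sin_le_one _))
      · rw [hw0, one_mul]
        exact le_add_of_nonneg_right (abs_nonneg _)
      · simp only [coeff_waveGroup_fst]
        have hc : Continuous fun t : ℝ =>
          Real.cos (|D.lam h| ^ (1 / 2 : ℝ) * t) * coeff D _ x.fst h +
          Real.sin (|D.lam h| ^ (1 / 2 : ℝ) * t) / |D.lam h| ^ (1 / 2 : ℝ) * coeff D _ x.snd h := by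
          fun_prop
        simpa using (hc.tendsto 0).mono_left nhdsWithin_le_nhds
    · refine tendsto_interp _ _ _ hg (Eventually.of_forall fun t h => ?_) (fun h => ?_) fun h => ?_
      · have h1 : |D.lam h| ^ ((0 : ℝ) / 2 - 1 / 2) * coeff D _ (waveGroup D t x).snd h =
            -Real.sin (|D.lam h| ^ (1 / 2 : ℝ) * t) * coeff D _ x.fst h +
            Real.cos (|D.lam h| ^ (1 / 2 : ℝ) * t) *
              ((|D.lam h| ^ (1 / 2 : ℝ))⁻¹ * coeff D _ x.snd h) := by
          have := (hω h).ne'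
          rw [hw, coeff_waveGroup_snd]
          field_simp
        rw [h1]
        refine (abs_add_le _ _).trans ?_
        rw [abs_mul, abs_mul (Real.cos _), abs_neg]
        exact add_le_add (mul_le_of_le_one_left (abs_nonneg _) (Real.abs_sin_le_one _))
          (mul_le_of_le_one_left (abs_nonneg _) (Real.abs_cos_le_one _))
      · rw [hw]
        exact le_add_of_nonneg_left (abs_nonneg _)
      · simp only [coeff_waveGroup_snd]
        have hc : Continuous fun t : ℝ =>
          -(|D.lam h| ^ (1 / 2 : ℝ) * Real.sin (|D.lam h| ^ (1 / 2 : ℝ) * t)) *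
            coeff D _ x.fst h +
          Real.cos (|D.lam h| ^ (1 / 2 : ℝ) * t) * coeff D _ x.snd h := by
          fun_prop
        simpa using (hc.tendsto 0).mono_left nhdsWithin_le_nhds
  generator x y := by
    rw [LinearPMap.mem_graph_iff]
    have hω := freq_pos D
    have hw : ∀ h, |D.lam h| ^ ((0 : ℝ) / 2 - 1 / 2) = (|D.lam h| ^ (1 / 2 : ℝ))⁻¹ := fun h => by
      rw [← Real.rpow_neg (abs_nonneg _)]
      norm_num
    have hw0 : ∀ h, |D.lam h| ^ ((0 : ℝ) / 2) = 1 := fun h => by simp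
    constructor
    · rintro ⟨z, hz, hzy⟩
      dsimp only at hz hzy
      subst hz
      have hm1 : Summable fun h => (|D.lam h| ^ (1 / 2 : ℝ) * coeff D _ z.1.fst h) ^ 2 := z.2.1
      have hm2 : Summable fun h => (|D.lam h| ^ ((0 : ℝ) / 2) * coeff D _ z.1.snd h) ^ 2 :=
        (mem_interp_zero_iff D).1 z.2.2
      have hg : Summable fun h => (|D.lam h| ^ (1 / 2 : ℝ) * |coeff D _ z.1.fst h| +
          |coeff D _ z.1.snd h|) ^ 2 := by
        refine Summable.of_nonneg_of_le (fun h => sq_nonneg _) (fun h => ?_)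
          ((hm1.mul_left 2).add (hm2.mul_left 2))
        rw [hw0, one_mul, mul_pow _ (coeff D _ z.1.fst h), ← sq_abs (coeff D _ z.1.fst h),
          ← sq_abs (coeff D _ z.1.snd h)]
        nlinarith [sq_nonneg (|D.lam h| ^ (1 / 2 : ℝ) * |coeff D _ z.1.fst h| -
          |coeff D _ z.1.snd h|)]
      have hy1 : ∀ h, coeff D _ y.fst h = coeff D _ z.1.snd h := fun h => by rw [← hzy]; rfl
      have hy2 : ∀ h, coeff D _ y.snd h = D.lam h * coeff D _ z.1.fst h := fun h => by
        rw [← hzy]; rfl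
      have hcos : ∀ (t : ℝ), 0 < t → ∀ h,
          |t⁻¹ * (Real.cos (|D.lam h| ^ (1 / 2 : ℝ) * t) - 1)| ≤ |D.lam h| ^ (1 / 2 : ℝ) := by
        intro t ht h
        have := Real.abs_cos_sub_cos_le (|D.lam h| ^ (1 / 2 : ℝ) * t) 0
        rw [Real.cos_zero, sub_zero, abs_of_pos (mul_pos (hω h) ht)] at this
        rw [abs_mul, abs_of_pos (inv_pos.2 ht), inv_mul_le_iff₀ ht]
        linarith
      have hsin : ∀ (t : ℝ), 0 < t → ∀ h,
          |t⁻¹ * Real.sin (|D.lam h| ^ (1 / 2 : ℝ) * t)| ≤ |D.lam h| ^ (1 / 2 : ℝ) := by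
        intro t ht h
        have := Real.abs_sin_le_abs (x := |D.lam h| ^ (1 / 2 : ℝ) * t)
        rw [abs_of_pos (mul_pos (hω h) ht)] at this
        rw [abs_mul, abs_of_pos (inv_pos.2 ht), inv_mul_le_iff₀ ht]
        linarith
      rw [tendsto_boldH]
      constructor
      · refine tendsto_interp _ _ _ hg ?_ (fun h => ?_) fun h => ?_
        · filter_upwards [self_mem_nhdsWithin] with t ht h
          have h1 : |D.lam h| ^ ((0 : ℝ) / 2) *
              coeff D _ (t⁻¹ • (waveGroup D t z.1 - z.1)).fst h =
              t⁻¹ * (Real.cos (|D.lam h| ^ (1 / 2 : ℝ) * t) - 1) * coeff D _ z.1.fst h +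
              (|D.lam h| ^ (1 / 2 : ℝ))⁻¹ * (t⁻¹ * Real.sin (|D.lam h| ^ (1 / 2 : ℝ) * t)) *
                coeff D _ z.1.snd h := by
            rw [hw0, one_mul]
            change t⁻¹ * (coeff D _ (waveGroup D t z.1).fst h - coeff D _ z.1.fst h) = _
            rw [coeff_waveGroup_fst]
            ring
          rw [h1]
          refine (abs_add_le _ _).trans ?_
          rw [abs_mul, abs_mul _ (coeff D _ z.1.snd h)]
          refine add_le_add (mul_le_mul_of_nonneg_right (hcos t ht h) (abs_nonneg _))
            (mul_le_of_le_one_left (abs_nonneg _) ?_)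
          rw [abs_mul, abs_of_pos (inv_pos.2 (hω h)), inv_mul_le_iff₀ (hω h), mul_one]
          exact hsin t ht h
        · rw [hw0, one_mul, hy1]
          exact le_add_of_nonneg_left (by have := hω h; positivity)
        · rw [hy1]
          exact tendsto_slope_fst D z.1 h
      · refine tendsto_interp _ _ _ hg ?_ (fun h => ?_) fun h => ?_
        · filter_upwards [self_mem_nhdsWithin] with t ht h
          have h1 : |D.lam h| ^ ((0 : ℝ) / 2 - 1 / 2) *
              coeff D _ (t⁻¹ • (waveGroup D t z.1 - z.1)).snd h =
              -(t⁻¹ * Real.sin (|D.lam h| ^ (1 / 2 : ℝ) * t)) * coeff D _ z.1.fst h +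
              (|D.lam h| ^ (1 / 2 : ℝ))⁻¹ *
                (t⁻¹ * (Real.cos (|D.lam h| ^ (1 / 2 : ℝ) * t) - 1)) * coeff D _ z.1.snd h := by
            rw [hw]
            change _ * (t⁻¹ * (coeff D _ (waveGroup D t z.1).snd h - coeff D _ z.1.snd h)) = _
            rw [coeff_waveGroup_snd]
            have := (hω h).ne'
            field_simp
            ring
          rw [h1]
          refine (abs_add_le _ _).trans ?_
          rw [abs_mul, abs_mul _ (coeff D _ z.1.snd h), abs_neg]
          refine add_le_add (mul_le_mul_of_nonneg_right (hsin t ht h) (abs_nonneg _))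
            (mul_le_of_le_one_left (abs_nonneg _) ?_)
          rw [abs_mul, abs_of_pos (inv_pos.2 (hω h)), inv_mul_le_iff₀ (hω h), mul_one]
          exact hcos t ht h
        · have h1 : |D.lam h| ^ ((0 : ℝ) / 2 - 1 / 2) * coeff D _ y.snd h =
              -(|D.lam h| ^ (1 / 2 : ℝ) * coeff D _ z.1.fst h) := by
            rw [hw, hy2, inv_mul_eq_iff_eq_mul₀ (hω h).ne']
            linear_combination (coeff D _ z.1.fst h) * freq_sq D h
          rw [h1, abs_neg, abs_mul, abs_of_pos (hω h)]
          exact le_add_of_nonneg_right (abs_nonneg _)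
        · rw [hy2]
          exact tendsto_slope_snd D z.1 h
    · intro hlim
      rw [tendsto_boldH] at hlim
      have hy1 : ∀ h, coeff D _ y.fst h = coeff D _ x.snd h := fun h =>
        tendsto_nhds_unique (tendsto_coeff hlim.1 h) (tendsto_slope_fst D x h)
      have hy2 : ∀ h, coeff D _ y.snd h = D.lam h * coeff D _ x.fst h := fun h =>
        tendsto_nhds_unique (tendsto_coeff hlim.2 h) (tendsto_slope_snd D x h)
      have hx1 : coeff D _ x.fst ∈ interpSubmodule D (1 / 2) := by
        refine (coeff_mem y.snd).congr fun h => ?_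
        have h1 : (|D.lam h| ^ (1 / 2 : ℝ))⁻¹ * (D.lam h * coeff D _ x.fst h) =
            -(|D.lam h| ^ (1 / 2 : ℝ) * coeff D _ x.fst h) := by
          rw [inv_mul_eq_iff_eq_mul₀ (hω h).ne']
          linear_combination (coeff D _ x.fst h) * freq_sq D h
        rw [hw, hy2, h1, neg_sq]
      have hx2 : coeff D _ x.snd ∈ interpSubmodule D (1 / 2 - 1 / 2) := by
        rw [mem_interp_zero_iff, ← funext hy1]
        exact coeff_mem y.fst
      exact ⟨⟨x, hx1, hx2⟩, rfl, boldH_ext _ (fun h => (hy1 h).symm) fun h => (hy2 h).symm⟩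

/-- The test functions `φ_i (v₁, v₂) = exp(-‖v_i‖²)`, `i ∈ {1, 2}`, on `𝐇_0`, where `v_i` is
measured in the norm of `H_{1/2 - i/2}`. -/
noncomputable def testFun (i : ℕ) (v : BoldH D 0) : ℝ :=
  if i = 1 then Real.exp (-‖v.fst‖ ^ 2) else Real.exp (-‖v.snd‖ ^ 2)

end Spaces

/-- `X = 𝐗^I = ∫_0^T e^{(T - s)𝐀} 𝐏_I 𝐁 dW_s` almost surely. -/
def IsGalerkinSolution {Ω : Type*} {mΩ : MeasurableSpace Ω} (P : Measure Ω)
    {H : Type*} [NormedAddCommGroup H] [InnerProductSpace ℝ H] {ι : Type*}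
    (D : WaveData ι) (e : HilbertBasis ι ℝ H) {T : ℝ} (W : Set.Icc (0 : ℝ) T → H → Ω → ℝ)
    (I : Set ι) (X : Ω → BoldH D 0) : Prop :=
  IsWienerIntegral P e W (fun s => (waveGroup D (T - s)).comp ((boldP D 0 I).comp (boldB D e))) X

end StochWave

open StochWave

/-!
Fix `i`. In the orthonormal coordinates `compCoord D i h` of the `i`-th component, the integrand
`e^{(T-s)𝐀} 𝐏_I 𝐁` is diagonal: coordinate `h` sees the noise only through `⟨h, ·⟩`, multiplied by
`coordKernel`, that is by `μ_h |λ_h|^{-1/2} sin (|λ_h|^{1/2} (T - s))` for `i = 1`, with `cos` in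
place of `sin` for `i = 2`, and by `0` for `h ∉ I`. So the coordinates of `𝐗^I` are independent
centred Gaussians, with variances (`coordVar`, for `h ∈ I`)
`σ_h = μ_h² / |λ_h| * T / 2 * (1 + (-1)^i sin x_h / x_h)`, where `x_h = 2 |λ_h|^{1/2} T`,
and hence `𝔼[φ_i(𝐗^I)] = ∏_{h ∈ I} (1 + 2 σ_h)^{-1/2}` (`IsGalerkinSolution.tendsto_prod`).

The probabilistic input is that a continuous linear functional `ℓ` of a Wiener integral is centred
Gaussian with variance given by the Itô isometry (`IsWienerIntegral.hasLaw`). For elementary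
integrands the functional is a finite combination of values `W t g`, which is treated by induction
on the largest time (`IsCylindricalWiener.hasLaw_sum`). The general case is a limit in `L²`.
Applied to all finite combinations of coordinates, this gives their joint characteristic function
and thus their independence.

Under the assumptions on `λ` and `μ`, and with `q = p (1 - 2 δ) > 1` and `K = T c^{2 δ - 1}`, the
variance of the `n`-th coordinate lies between `m K / 2 * n^{-q}` and `K n^{-q}`, where `m` is the
first factor of the lower bound. With `S` the sum of the variances beyond `N`, the difference of
the two products is at least `S exp (-3/2 ∑ σ)` (`mul_exp_le_prod_sub_prod`), and comparing
`∑ n^{-q}` with an integral finishes the proof (`le_prod_sub_limit`).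
-/

namespace StochWave

/-! ### Gaussian laws of linear functionals of the Wiener process -/

section Wiener

variable {Ω : Type*} {mΩ : MeasurableSpace Ω} {P : Measure Ω}
  {H : Type*} [NormedAddCommGroup H] [InnerProductSpace ℝ H] {T : ℝ}
  {F : Filtration (Set.Icc (0 : ℝ) T) mΩ} {hT : 0 < T} {W : Set.Icc (0 : ℝ) T → H → Ω → ℝ}

/-- The covariance form `∑ j k, min (t j) (t k) ⟨v j, v k⟩` of `∑ k, W_{t k} (v k)`. -/
noncomputable def wienerCov {κ : Type*} (s : Finset κ) (t : κ → Set.Icc (0 : ℝ) T) (v : κ → H) :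
    ℝ :=
  ∑ j ∈ s, ∑ k ∈ s, min (t j : ℝ) (t k) * inner ℝ (v j) (v k)

theorem wienerCov_insert {κ : Type*} [DecidableEq κ] {s : Finset κ} {a : κ} (ha : a ∉ s)
    (t : κ → Set.Icc (0 : ℝ) T) (v : κ → H) :
    wienerCov (insert a s) t v = (t a : ℝ) * ‖v a‖ ^ 2 +
      2 * ∑ k ∈ s, min (t a : ℝ) (t k) * inner ℝ (v a) (v k) + wienerCov s t v := by
  have h1 : ∑ j ∈ s, min (t j : ℝ) (t a) * inner ℝ (v j) (v a) =
      ∑ k ∈ s, min (t a : ℝ) (t k) * inner ℝ (v a) (v k) :=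
    Finset.sum_congr rfl fun j _ => by rw [min_comm, real_inner_comm]
  simp only [wienerCov, Finset.sum_insert ha, Finset.sum_add_distrib, min_self,
    real_inner_self_eq_norm_sq]
  rw [h1]
  ring

theorem wienerCov_add_single {κ : Type*} [DecidableEq κ] {s : Finset κ} {m : κ} (hm : m ∈ s)
    (t : κ → Set.Icc (0 : ℝ) T) (v : κ → H) (w : H) :
    wienerCov s t (fun k => v k + if k = m then w else 0) = (t m : ℝ) * ‖w‖ ^ 2 +
      2 * ∑ k ∈ s, min (t m : ℝ) (t k) * inner ℝ w (v k) + wienerCov s t v := by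
  have h1 : ∑ j ∈ s, min (t j : ℝ) (t m) * inner ℝ (v j) w =
      ∑ k ∈ s, min (t m : ℝ) (t k) * inner ℝ w (v k) :=
    Finset.sum_congr rfl fun j _ => by rw [min_comm, real_inner_comm]
  have h2 : ∀ j k, (inner ℝ (v j + if j = m then w else 0) (v k + if k = m then w else 0) : ℝ) =
      inner ℝ (v j) (v k) + (if k = m then inner ℝ (v j) w else 0) +
        ((if j = m then inner ℝ w (v k) else 0) +
          if j = m then (if k = m then ‖w‖ ^ 2 else 0) else 0) := by
    intro j k
    split_ifs <;> (simp [inner_add_left, inner_add_right]; try ring)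
  simp only [wienerCov, h2, mul_add, Finset.sum_add_distrib, mul_ite, mul_zero,
    Finset.sum_ite_eq', hm, if_true, Finset.sum_ite_irrel, Finset.sum_const_zero, min_self]
  rw [h1]
  ring

/-- Finite linear combinations of values of a cylindrical Wiener process are centred Gaussian. The
induction removes the largest time `t a`: up to the increment of `W` after the second largest time
`t m`, which is independent of the past, the weight `v a` can be moved to `t m`. -/
theorem IsCylindricalWiener.hasLaw_sum [IsProbabilityMeasure P] (hW : IsCylindricalWiener F hT P W)
    {κ : Type*} (t : κ → Set.Icc (0 : ℝ) T) (s : Finset κ) (v : κ → H) :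
    0 ≤ wienerCov s t v ∧
      HasLaw (fun ω => ∑ k ∈ s, W (t k) (v k) ω)
        (gaussianReal 0 (wienerCov s t v).toNNReal) P := by
  classical
  induction s using Finset.induction_on_max_value t generalizing v with
  | empty =>
    refine ⟨by simp [wienerCov], ?_⟩
    simp only [wienerCov, Finset.sum_empty, Real.toNNReal_zero, gaussianReal_zero_var]
    exact ⟨aemeasurable_const, by simp [Measure.map_const]⟩
  | insert a s has hmax ih =>
    rcases s.eq_empty_or_nonempty with rfl | hne
    · have h0 : (0 : ℝ) ≤ t a := (t a).2.1
      have hinc := hW.gaussian_increments ⟨0, Set.left_mem_Icc.2 hT.le⟩ (t a) h0 (v a)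
      simp only [sub_zero] at hinc
      refine ⟨by simp only [wienerCov_insert has]; simp [wienerCov]; positivity, ?_⟩
      rw [wienerCov_insert has]
      simp only [Finset.sum_empty, mul_zero, add_zero, wienerCov, insert_empty_eq,
        Finset.sum_singleton]
      refine hinc.congr ?_
      filter_upwards [hW.initial (v a)] with ω hω
      rw [hω, sub_zero]
    · obtain ⟨m, hms, hm⟩ := s.exists_max_image t hne
      set v' : κ → H := fun k => v k + if k = m then v a else 0 with hv'
      obtain ⟨hq, hlaw⟩ := ih v'
      have htm : (t m : ℝ) ≤ t a := hmax m hms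
      have hQ : wienerCov (insert a s) t v =
          ((t a : ℝ) - t m) * ‖v a‖ ^ 2 + wienerCov s t v' := by
        have h3 : ∑ k ∈ s, min (t a : ℝ) (t k) * inner ℝ (v a) (v k) =
            ∑ k ∈ s, min (t m : ℝ) (t k) * inner ℝ (v a) (v k) :=
          Finset.sum_congr rfl fun k hk => by
            rw [min_eq_right (show (t k : ℝ) ≤ t a from hmax k hk),
              min_eq_right (show (t k : ℝ) ≤ t m from hm k hk)]
        rw [wienerCov_insert has, hv', wienerCov_add_single hms, h3]
        ring
      have h4 : 0 ≤ ((t a : ℝ) - t m) * ‖v a‖ ^ 2 :=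
        mul_nonneg (sub_nonneg.2 htm) (sq_nonneg _)
      refine ⟨hQ ▸ add_nonneg h4 hq, ?_⟩
      have hinc := hW.gaussian_increments (t m) (t a) htm (v a)
      have hpast : Measurable[F (t m)] (fun ω => ∑ k ∈ s, W (t k) (v' k) ω) :=
        Finset.measurable_sum s fun k hk =>
          (hW.adapted (t k) (v' k)).mono (F.mono (hm k hk)) le_rfl
      have hind : IndepFun (fun ω => W (t a) (v a) ω - W (t m) (v a) ω)
          (fun ω => ∑ k ∈ s, W (t k) (v' k) ω) P := by
        rw [IndepFun_iff_Indep]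
        refine indep_of_indep_of_le_right (indep_of_indep_of_le_left
          (hW.indep_increments (t m) (t a) htm) ?_) hpast.comap_le
        exact le_iSup (fun g : H => MeasurableSpace.comap
          (fun ω => W (t a) g ω - W (t m) g ω) inferInstance) (v a)
      have hsum := gaussianReal_add_gaussianReal_of_indepFun hind hinc.map_eq hlaw.map_eq
      rw [add_zero, ← Real.toNNReal_add h4 hq, ← hQ] at hsum
      have hmeas := hinc.aemeasurable.add hlaw.aemeasurable
      refine HasLaw.congr ⟨hmeas, hsum⟩ ?_
      have hlin : ∀ᵐ ω ∂P, W (t m) (v m + v a) ω = W (t m) (v m) ω + W (t m) (v a) ω := by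
        filter_upwards [hW.linear (t m) 1 1 (v m) (v a)] with ω hω
        simpa using hω
      filter_upwards [hlin] with ω hω
      have h5 : ∀ k ∈ s, W (t k) (v' k) ω =
          W (t k) (v k) ω + if k = m then W (t m) (v a) ω else 0 := by
        intro k _
        by_cases hkm : k = m
        · subst hkm
          simpa [hv'] using hω
        · simp [hv', hkm]
      simp only [Pi.add_apply, Finset.sum_insert has, Finset.sum_congr rfl h5,
        Finset.sum_add_distrib, Finset.sum_ite_eq', hms, if_true]
      ring

end Wiener

/-! ### Gaussian laws of linear functionals of Wiener integrals -/

theorem eLpNorm_two_sq {α E : Type*} {m : MeasurableSpace α} {μ : Measure α}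
    [NormedAddCommGroup E] (f : α → E) :
    eLpNorm f 2 μ ^ 2 = ∫⁻ x, ‖f x‖ₑ ^ 2 ∂μ := by
  have := eLpNorm_nnreal_pow_eq_lintegral (μ := μ) (f := f) (p := 2) (by norm_num)
  simpa using this

theorem tendsto_eLpNorm_two_zero {α E : Type*} {m : MeasurableSpace α} {μ : Measure α}
    [NormedAddCommGroup E] {f : ℕ → α → E}
    (h : Tendsto (fun n => ∫⁻ x, ‖f n x‖ₑ ^ 2 ∂μ) atTop (𝓝 0)) :
    Tendsto (fun n => eLpNorm (f n) 2 μ) atTop (𝓝 0) := by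
  have h1 := h.ennrpow_const (1 / 2)
  rw [ENNReal.zero_rpow_of_pos (by norm_num)] at h1
  refine h1.congr fun n => ?_
  rw [← eLpNorm_two_sq, ← ENNReal.rpow_natCast, ← ENNReal.rpow_mul]
  norm_num

/-- The class of centred Gaussian laws is closed under convergence in `L²`. -/
theorem hasLaw_gaussianReal_of_tendsto {Ω : Type*} {mΩ : MeasurableSpace Ω} {P : Measure Ω}
    [IsProbabilityMeasure P] {Y : ℕ → Ω → ℝ} {Z : Ω → ℝ} {q : ℕ → ℝ} {r : ℝ}
    (hY : ∀ n, HasLaw (Y n) (gaussianReal 0 (q n).toNNReal) P) (hZ : AEStronglyMeasurable Z P)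
    (hYZ : Tendsto (fun n => ∫⁻ ω, ‖Y n ω - Z ω‖ₑ ^ 2 ∂P) atTop (𝓝 0))
    (hq : Tendsto q atTop (𝓝 r)) :
    HasLaw Z (gaussianReal 0 r.toNNReal) P := by
  have hd := (tendstoInMeasure_of_tendsto_eLpNorm (p := 2) (by norm_num)
    (fun n => (hY n).aemeasurable.aestronglyMeasurable) hZ
    (tendsto_eLpNorm_two_zero hYZ)).tendstoInDistribution fun n => (hY n).aemeasurable
  refine ⟨hZ.aemeasurable, ?_⟩
  have := Measure.isProbabilityMeasure_map (μ := P) hZ.aemeasurable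
  refine Measure.ext_of_charFun (funext fun t => ?_)
  refine tendsto_nhds_unique (ProbabilityMeasure.tendsto_iff_tendsto_charFun.1 hd.tendsto t) ?_
  simp only [ProbabilityMeasure.coe_mk, (hY _).map_eq, charFun_gaussianReal]
  have h1 : Tendsto (fun n => ((q n).toNNReal : ℝ)) atTop (𝓝 (r.toNNReal : ℝ)) :=
    (NNReal.continuous_coe.tendsto _).comp ((continuous_real_toNNReal.tendsto _).comp hq)
  have h2 := (Complex.continuous_ofReal.tendsto _).comp h1
  exact (Complex.continuous_exp.tendsto _).comp (((h2.mul_const _).div_const _).const_sub _)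

section Elementary

variable {T : ℝ} {H U : Type*} [NormedAddCommGroup H] [InnerProductSpace ℝ H]
  [NormedAddCommGroup U] [InnerProductSpace ℝ U]

/-- The `L²([0, T])` norm of a step function, computed from the covariance form. -/
theorem integral_norm_sq_step {κ : Type*} (s : Finset κ)
    (t : κ → Set.Icc (0 : ℝ) T) (v : κ → H) :
    ∫ x in Set.Icc 0 T, ‖∑ k ∈ s, (Set.Iic (t k : ℝ)).indicator (fun _ => v k) x‖ ^ 2 =
      wienerCov s t v := by
  have h1 : ∀ x, ‖∑ k ∈ s, (Set.Iic (t k : ℝ)).indicator (fun _ => v k) x‖ ^ 2 =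
      ∑ j ∈ s, ∑ k ∈ s,
        (Set.Iic (min (t j : ℝ) (t k))).indicator (fun _ => (inner ℝ (v j) (v k) : ℝ)) x := by
    intro x
    rw [← real_inner_self_eq_norm_sq, sum_inner]
    refine Finset.sum_congr rfl fun j _ => ?_
    rw [inner_sum]
    refine Finset.sum_congr rfl fun k _ => ?_
    by_cases hj : x ≤ t j <;> by_cases hk : x ≤ t k <;> simp [Set.indicator, hj, hk]
  have hint : ∀ j k, Integrable ((Set.Iic (min (t j : ℝ) (t k))).indicator
      (fun _ => (inner ℝ (v j) (v k) : ℝ))) (volume.restrict (Set.Icc 0 T)) := fun j k =>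
    (integrable_const _).indicator measurableSet_Iic
  simp only [h1]
  rw [integral_finsetSum _ fun j _ => integrable_finsetSum _ fun k _ => hint j k]
  refine Finset.sum_congr rfl fun j _ => ?_
  rw [integral_finsetSum _ fun k _ => hint j k]
  refine Finset.sum_congr rfl fun k _ => ?_
  rw [integral_indicator measurableSet_Iic, Measure.restrict_restrict measurableSet_Iic]
  have h2 : Set.Iic (min (t j : ℝ) (t k)) ∩ Set.Icc 0 T = Set.Icc 0 (min (t j : ℝ) (t k)) := by
    ext x
    have := (t j).2.2
    simp only [Set.mem_inter_iff, Set.mem_Iic, Set.mem_Icc, le_min_iff]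
    constructor
    · rintro ⟨h, h', -⟩
      exact ⟨h', h⟩
    · rintro ⟨h', h⟩
      exact ⟨h, h', h.1.trans this⟩
  rw [h2]
  simp [(t j).2.1, (t k).2.1]

/-- The step function with values in `H` which represents the functionals `ℓ ∘ E(s)`. -/
noncomputable def Elementary.rep (E : Elementary T H U) (ℓ : U →L[ℝ] ℝ) (s : ℝ) : H :=
  ∑ k, (Set.Ioc (E.a k : ℝ) (E.b k : ℝ)).indicator (fun _ => ℓ (E.u k) • E.g k) s

theorem Elementary.inner_rep (E : Elementary T H U) (ℓ : U →L[ℝ] ℝ) (s : ℝ) (x : H) :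
    inner ℝ (E.rep ℓ s) x = ℓ (E.toFun s x) := by
  simp only [rep, toFun, sum_inner, _root_.sum_apply, map_sum]
  refine Finset.sum_congr rfl fun k _ => ?_
  by_cases hs : s ∈ Set.Ioc (E.a k : ℝ) (E.b k : ℝ)
  · simp [hs, inner_smul_left, mul_comm]
  · simp [hs]

theorem Elementary.memLp_rep (E : Elementary T H U) (ℓ : U →L[ℝ] ℝ) :
    MemLp (E.rep ℓ) 2 (volume.restrict (Set.Icc 0 T)) :=
  memLp_finsetSum _ fun _ _ => (memLp_const _).indicator measurableSet_Ioc

/-- Itô isometry for linear functionals of elementary integrals, together with Gaussianity. -/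
theorem Elementary.hasLaw_integral {Ω : Type*} {mΩ : MeasurableSpace Ω} {P : Measure Ω}
    [IsProbabilityMeasure P] {F : Filtration (Set.Icc (0 : ℝ) T) mΩ} {hT : 0 < T}
    {W : Set.Icc (0 : ℝ) T → H → Ω → ℝ} (hW : IsCylindricalWiener F hT P W)
    (E : Elementary T H U) (ℓ : U →L[ℝ] ℝ) :
    HasLaw (fun ω => ℓ (E.integral W ω))
      (gaussianReal 0 (∫ s in Set.Icc 0 T, ‖E.rep ℓ s‖ ^ 2).toNNReal) P := by
  -- an increment over `(a k, b k]` contributes the weights `±ℓ (u k) • g k` at `b k` and `a k`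
  set t : Fin E.n ⊕ Fin E.n → Set.Icc (0 : ℝ) T := Sum.elim E.b E.a
  set v : Fin E.n ⊕ Fin E.n → H :=
    Sum.elim (fun k => ℓ (E.u k) • E.g k) fun k => (-ℓ (E.u k)) • E.g k
  have h1 : ∀ s, E.rep ℓ s = ∑ k, (Set.Iic (t k : ℝ)).indicator (fun _ => v k) s := by
    intro s
    rw [Fintype.sum_sum_type, ← Finset.sum_add_distrib, rep]
    refine Finset.sum_congr rfl fun k _ => ?_
    have hab : (E.a k : ℝ) ≤ E.b k := E.le k
    simp only [t, v, Sum.elim_inl, Sum.elim_inr, Set.indicator, Set.mem_Ioc, Set.mem_Iic]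
    by_cases ha : s ≤ E.a k
    · simp [ha, ha.trans hab, not_lt.2 ha]
    · simp [ha, not_le.1 ha]
  simp only [h1, integral_norm_sq_step]
  refine (hW.hasLaw_sum t Finset.univ v).2.congr ?_
  have h2 : ∀ᵐ ω ∂P, ∀ k, W (E.b k) (ℓ (E.u k) • E.g k) ω = ℓ (E.u k) * W (E.b k) (E.g k) ω := by
    refine ae_all_iff.2 fun k => ?_
    filter_upwards [hW.linear (E.b k) (ℓ (E.u k)) 0 (E.g k) 0] with ω hω
    simpa using hω
  have h3 : ∀ᵐ ω ∂P, ∀ k,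
      W (E.a k) ((-ℓ (E.u k)) • E.g k) ω = (-ℓ (E.u k)) * W (E.a k) (E.g k) ω := by
    refine ae_all_iff.2 fun k => ?_
    filter_upwards [hW.linear (E.a k) (-ℓ (E.u k)) 0 (E.g k) 0] with ω hω
    simpa using hω
  filter_upwards [h2, h3] with ω hω2 hω3
  simp only [integral, map_sum, map_smul, Fintype.sum_sum_type, ← Finset.sum_add_distrib, t, v,
    Sum.elim_inl, Sum.elim_inr, hω2, hω3]
  exact Finset.sum_congr rfl fun k _ => by rw [smul_eq_mul]; ring

/-- By Parseval, the representative `w` of `ℓ ∘ L` has norm at most `‖ℓ‖ ‖L‖_HS`. -/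
theorem enorm_sq_le_hsNormSq {ι : Type*} (e : HilbertBasis ι ℝ H) (L : H →L[ℝ] U) (ℓ : U →L[ℝ] ℝ)
    (w : H) (hw : ∀ x, inner ℝ w x = ℓ (L x)) : ‖w‖ₑ ^ 2 ≤ ‖ℓ‖ₑ ^ 2 * hsNormSq e L := by
  have h1 := e.hasSum_inner_mul_inner w w
  have h2 : ∀ i, (inner ℝ w (e i) * inner ℝ (e i) w : ℝ) = ‖ℓ (L (e i))‖ ^ 2 := fun i => by
    rw [real_inner_comm w (e i), hw, Real.norm_eq_abs, sq_abs, sq]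
  simp only [h2, real_inner_self_eq_norm_sq] at h1
  have h3 : ‖w‖ₑ ^ 2 = ∑' i, ‖ℓ (L (e i))‖ₑ ^ 2 := by
    have h4 : ∀ {V : Type _} [NormedAddCommGroup V] (y : V), ‖y‖ₑ ^ 2 = ENNReal.ofReal (‖y‖ ^ 2) :=
      fun y => by rw [ENNReal.ofReal_pow (norm_nonneg _), ofReal_norm]
    rw [h4, ← h1.tsum_eq, ENNReal.ofReal_tsum_of_nonneg (fun i => sq_nonneg _) h1.summable]
    exact tsum_congr fun i => by rw [ENNReal.ofReal_pow (norm_nonneg _), ofReal_norm]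
  rw [h3, hsNormSq, ← ENNReal.tsum_mul_left]
  refine ENNReal.tsum_le_tsum fun i => ?_
  rw [← mul_pow]
  gcongr
  exact ℓ.le_opENorm _

/-- If the functionals `ℓ ∘ Φ(s)` are represented by `f(s) ∈ H`, then `ℓ(∫ Φ dW)` is centred
Gaussian with variance `∫ ‖f(s)‖² ds`. -/
theorem IsWienerIntegral.hasLaw {Ω : Type*} {mΩ : MeasurableSpace Ω} {P : Measure Ω}
    [IsProbabilityMeasure P] {F : Filtration (Set.Icc (0 : ℝ) T) mΩ} {hT : 0 < T}
    {W : Set.Icc (0 : ℝ) T → H → Ω → ℝ} (hW : IsCylindricalWiener F hT P W)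
    {ι : Type*} {e : HilbertBasis ι ℝ H} {Φ : ℝ → H →L[ℝ] U} {X : Ω → U}
    (hX : IsWienerIntegral P e W Φ X) (ℓ : U →L[ℝ] ℝ) {f : ℝ → H}
    (hf : MemLp f 2 (volume.restrict (Set.Icc 0 T))) (hfΦ : ∀ s x, inner ℝ (f s) x = ℓ (Φ s x)) :
    HasLaw (fun ω => ℓ (X ω))
      (gaussianReal 0 (∫ s in Set.Icc 0 T, ‖f s‖ ^ 2).toNNReal) P := by
  obtain ⟨-, hXm, E, hE, hEX⟩ := hX
  refine hasLaw_gaussianReal_of_tendsto (fun n => (E n).hasLaw_integral hW ℓ)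
    (ℓ.continuous.comp_aestronglyMeasurable hXm) ?_ ?_
  · have h1 : Tendsto (fun n => ‖ℓ‖ₑ ^ 2 * ∫⁻ ω, ‖(E n).integral W ω - X ω‖ₑ ^ 2 ∂P) atTop
        (𝓝 0) := by
      simpa using ENNReal.Tendsto.const_mul hEX (Or.inr (by simp))
    refine tendsto_of_tendsto_of_tendsto_of_le_of_le tendsto_const_nhds h1
      (fun n => zero_le) fun n => ?_
    dsimp only
    rw [← lintegral_const_mul' _ _ (by simp)]
    refine lintegral_mono fun ω => ?_
    rw [← map_sub, ← mul_pow]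
    gcongr
    exact ℓ.le_opENorm _
  · have hn := fun n => (E n).memLp_rep ℓ
    have h1 : Tendsto (fun n => ‖ℓ‖ₑ ^ 2 * ∫⁻ s in Set.Icc 0 T,
        hsNormSq e ((E n).toFun s - Φ s)) atTop (𝓝 0) := by
      simpa using ENNReal.Tendsto.const_mul hE (Or.inr (by simp))
    have h2 : Tendsto (fun n => ∫⁻ s in Set.Icc 0 T, ‖((E n).rep ℓ - f) s‖ₑ ^ 2) atTop
        (𝓝 0) := by
      refine tendsto_of_tendsto_of_tendsto_of_le_of_le tendsto_const_nhds h1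
        (fun n => zero_le) fun n => ?_
      dsimp only
      rw [← lintegral_const_mul' _ _ (by simp)]
      refine lintegral_mono fun s => enorm_sq_le_hsNormSq e _ ℓ _ fun x => ?_
      rw [Pi.sub_apply, inner_sub_left, (E n).inner_rep, hfΦ, _root_.sub_apply,
        map_sub]
    have h3 : Tendsto (fun n => (hn n).toLp) atTop (𝓝 hf.toLp) :=
      (Lp.tendsto_Lp_iff_tendsto_eLpNorm'' _ hn _ hf).2 (tendsto_eLpNorm_two_zero h2)
    have h4 : ∀ {g : ℝ → H} (hg : MemLp g 2 (volume.restrict (Set.Icc 0 T))),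
        ∫ s in Set.Icc 0 T, ‖g s‖ ^ 2 = ‖hg.toLp‖ ^ 2 := by
      intro g hg
      rw [← real_inner_self_eq_norm_sq, L2.inner_def]
      refine integral_congr_ae ?_
      filter_upwards [hg.coeFn_toLp] with s hs
      rw [hs, real_inner_self_eq_norm_sq]
    simp only [h4 hf, h4 (hn _)]
    exact h3.norm.pow 2

end Elementary

/-! ### Exponential moments of sums of squares of Gaussian coordinates -/

theorem integral_exp_neg_sq_gaussianReal (v : ℝ≥0) :
    ∫ x, Real.exp (-x ^ 2) ∂(gaussianReal 0 v) = (√(1 + 2 * v))⁻¹ := by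
  rcases eq_or_ne v 0 with rfl | hv
  · simp
  have hv' : (0 : ℝ) < v := by positivity
  rw [integral_gaussianReal_eq_integral_smul hv]
  have h1 : ∀ x : ℝ, gaussianPDFReal 0 v x • Real.exp (-x ^ 2) =
      (√(2 * Real.pi * v))⁻¹ * Real.exp (-(1 + 1 / (2 * v)) * x ^ 2) := fun x => by
    rw [gaussianPDFReal, smul_eq_mul, mul_assoc, ← Real.exp_add]
    congr 2
    field_simp
    ring
  simp only [h1]
  rw [integral_const_mul, integral_gaussian, ← Real.sqrt_inv, ← Real.sqrt_inv,
    ← Real.sqrt_mul (by positivity)]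
  congr 1
  field_simp
  ring

section Joint

variable {T : ℝ} {H U : Type*} [NormedAddCommGroup H] [InnerProductSpace ℝ H]
  [NormedAddCommGroup U] [InnerProductSpace ℝ U]
  {Ω : Type*} {mΩ : MeasurableSpace Ω} {P : Measure Ω} [IsProbabilityMeasure P]
  {F : Filtration (Set.Icc (0 : ℝ) T) mΩ} {hT : 0 < T} {W : Set.Icc (0 : ℝ) T → H → Ω → ℝ}
  {ι : Type*} {e : HilbertBasis ι ℝ H} {Φ : ℝ → H →L[ℝ] U} {X : Ω → U}
  {ℓ : ι → U →L[ℝ] ℝ} {κ : ι → ℝ → ℝ}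

/-- Joint Gaussianity of the coordinates `ℓ h` of a Wiener integral whose integrand is diagonal in
the sense that `ℓ h ∘ Φ(s) = κ h s ⟨e h, ·⟩`. -/
theorem IsWienerIntegral.hasLaw_sum_coord (hW : IsCylindricalWiener F hT P W)
    (hX : IsWienerIntegral P e W Φ X) (hκ : ∀ h, Continuous (κ h))
    (hℓ : ∀ h s x, ℓ h (Φ s x) = κ h s * inner ℝ (e h) x) (J : Finset ι) (t : ι → ℝ) :
    HasLaw (fun ω => ∑ h ∈ J, t h * ℓ h (X ω))
      (gaussianReal 0 (∑ h ∈ J, t h ^ 2 * ∫ s in Set.Icc 0 T, κ h s ^ 2).toNNReal) P := by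
  classical
  have hf : MemLp (fun s => ∑ h ∈ J, (t h * κ h s) • e h) 2 (volume.restrict (Set.Icc 0 T)) := by
    refine memLp_finsetSum _ fun h _ => ?_
    have hc : Continuous fun s => (t h * κ h s) • e h := by have := hκ h; fun_prop
    have h1 : BddAbove ((fun s => ‖(t h * κ h s) • e h‖) '' Set.Icc 0 T) :=
      (isCompact_Icc.image hc.norm).bddAbove
    obtain ⟨C, hC⟩ := h1
    refine MemLp.of_bound hc.aestronglyMeasurable C ?_
    filter_upwards [ae_restrict_mem measurableSet_Icc] with s hs
    exact hC ⟨s, hs, rfl⟩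
  have h1 := IsWienerIntegral.hasLaw hW hX (∑ h ∈ J, t h • ℓ h) hf fun s x => by
    simp [sum_inner, inner_smul_left, hℓ, mul_assoc]
  have h2 : ∀ s, ‖∑ h ∈ J, (t h * κ h s) • e h‖ ^ 2 = ∑ h ∈ J, t h ^ 2 * κ h s ^ 2 := fun s => by
    rw [← real_inner_self_eq_norm_sq, e.orthonormal.inner_sum]
    exact Finset.sum_congr rfl fun h _ => by simp; ring
  have h3 : ∫ s in Set.Icc 0 T, ‖∑ h ∈ J, (t h * κ h s) • e h‖ ^ 2 =
      ∑ h ∈ J, t h ^ 2 * ∫ s in Set.Icc 0 T, κ h s ^ 2 := by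
    simp only [h2]
    rw [integral_finsetSum]
    · exact Finset.sum_congr rfl fun h _ => integral_const_mul _ _
    · intro h _
      have hc : Continuous fun s => t h ^ 2 * κ h s ^ 2 := by have := hκ h; fun_prop
      exact hc.continuousOn.integrableOn_compact isCompact_Icc
  rw [h3] at h1
  simpa using h1

theorem IsWienerIntegral.hasLaw_coord (hW : IsCylindricalWiener F hT P W)
    (hX : IsWienerIntegral P e W Φ X) (hκ : ∀ h, Continuous (κ h))
    (hℓ : ∀ h s x, ℓ h (Φ s x) = κ h s * inner ℝ (e h) x) (h : ι) :
    HasLaw (fun ω => ℓ h (X ω))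
      (gaussianReal 0 (∫ s in Set.Icc 0 T, κ h s ^ 2).toNNReal) P := by
  simpa using hX.hasLaw_sum_coord hW hκ hℓ {h} 1

/-- Coordinates of a Wiener integral which are driven by different directions of the noise are
independent. -/
theorem IsWienerIntegral.iIndepFun_coord (hW : IsCylindricalWiener F hT P W)
    (hX : IsWienerIntegral P e W Φ X) (hκ : ∀ h, Continuous (κ h))
    (hℓ : ∀ h s x, ℓ h (Φ s x) = κ h s * inner ℝ (e h) x) :
    iIndepFun (fun h ω => ℓ h (X ω)) P := by
  classical
  have hm : ∀ h, AEMeasurable (fun ω => ℓ h (X ω)) P := fun h =>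
    (hX.hasLaw_coord hW hκ hℓ h).aemeasurable
  refine iIndepFun_iff_finset.2 fun J => ?_
  refine (iIndepFun_iff_charFun_pi (X := J.restrict fun h ω => ℓ h (X ω))
    fun h => hm (h : ι)).2 fun t => ?_
  -- the joint characteristic function at `t` is that of `∑ t h * ℓ h` at `1`
  set t' : ι → ℝ := fun h => if hh : h ∈ J then t ⟨h, hh⟩ else 0 with ht'
  have hlaw := hX.hasLaw_sum_coord hW hκ hℓ J t'
  have hv : ∀ h, 0 ≤ ∫ s in Set.Icc 0 T, κ h s ^ 2 := fun h =>
    integral_nonneg fun s => sq_nonneg _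
  have hm2 : AEMeasurable (fun ω => WithLp.toLp 2 fun h : J => ℓ h (X ω)) P :=
    (WithLp.measurable_toLp 2 _).comp_aemeasurable (aemeasurable_pi_lambda _ fun h => hm h)
  have h1 : charFun (P.map (fun ω => WithLp.toLp 2 fun h : J => ℓ h (X ω))) t =
      charFun (P.map (fun ω => ∑ h ∈ J, t' h * ℓ h (X ω))) 1 := by
    rw [charFun_apply, charFun_apply, integral_map hm2 (by fun_prop),
      integral_map hlaw.aemeasurable (by fun_prop)]
    refine integral_congr_ae (Eventually.of_forall fun ω => ?_)
    dsimp only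
    congr 3
    rw [PiLp.inner_apply, ← Finset.sum_coe_sort J]
    simp [ht']
  have h2 : ∀ h : J, charFun (P.map (J.restrict (fun h ω => ℓ h (X ω)) h)) (t h) =
      Complex.exp (-((t' h ^ 2 * ∫ s in Set.Icc 0 T, κ h s ^ 2 : ℝ) : ℂ) / 2) := fun h => by
    rw [show J.restrict (fun h ω => ℓ h (X ω)) h = fun ω => ℓ h (X ω) from rfl,
      (hX.hasLaw_coord hW hκ hℓ h).map_eq, charFun_gaussianReal, Real.coe_toNNReal _ (hv h)]
    congr 1
    simp [ht']
    ring
  refine (h1.trans ?_).trans (Finset.prod_congr rfl fun h _ => (h2 h).symm)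
  rw [hlaw.map_eq, charFun_gaussianReal, Real.coe_toNNReal _
    (Finset.sum_nonneg fun h _ => mul_nonneg (sq_nonneg _) (hv h)), ← Complex.exp_sum,
    Finset.sum_coe_sort J
      (fun h => -((t' h ^ 2 * ∫ s in Set.Icc 0 T, κ h s ^ 2 : ℝ) : ℂ) / 2)]
  congr 1
  rw [← Finset.sum_div, Finset.sum_neg_distrib, ← Complex.ofReal_sum]
  simp
  ring

theorem IsWienerIntegral.integral_exp_neg_sum_sq (hW : IsCylindricalWiener F hT P W)
    (hX : IsWienerIntegral P e W Φ X) (hκ : ∀ h, Continuous (κ h))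
    (hℓ : ∀ h s x, ℓ h (Φ s x) = κ h s * inner ℝ (e h) x) (J : Finset ι) :
    ∫ ω, Real.exp (-∑ h ∈ J, ℓ h (X ω) ^ 2) ∂P =
      ∏ h ∈ J, (√(1 + 2 * ∫ s in Set.Icc 0 T, κ h s ^ 2))⁻¹ := by
  have hm : ∀ h, AEMeasurable (fun ω => ℓ h (X ω)) P := fun h =>
    (hX.hasLaw_coord hW hκ hℓ h).aemeasurable
  have h1 := (iIndepFun_iff_finset.1 (hX.iIndepFun_coord hW hκ hℓ) J).integral_fun_prod_comp
    (f := fun _ x => Real.exp (-x ^ 2)) (fun h => hm h) fun h => by fun_prop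
  have h2 : ∀ h : J, ∫ ω, Real.exp (-(J.restrict (fun h ω => ℓ h (X ω)) h ω) ^ 2) ∂P =
      (√(1 + 2 * ∫ s in Set.Icc 0 T, κ h s ^ 2))⁻¹ := fun h => by
    have h3 := hX.hasLaw_coord hW hκ hℓ h
    have h4 := integral_map (f := fun x : ℝ => Real.exp (-x ^ 2)) h3.aemeasurable (by fun_prop)
    rw [h3.map_eq, integral_exp_neg_sq_gaussianReal,
      Real.coe_toNNReal _ (integral_nonneg fun s => sq_nonneg _)] at h4
    exact h4.symm
  simp only [h2] at h1
  rw [Finset.prod_coe_sort J fun h => (√(1 + 2 * ∫ s in Set.Icc 0 T, κ h s ^ 2))⁻¹] at h1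
  rw [← h1]
  refine integral_congr_ae (Eventually.of_forall fun ω => ?_)
  dsimp only
  rw [← Finset.sum_neg_distrib, Real.exp_sum, ← Finset.prod_coe_sort]
  rfl

/-- Exponential moment of the full, possibly infinite, sum of squares of coordinates. -/
theorem IsWienerIntegral.tendsto_prod (hW : IsCylindricalWiener F hT P W)
    (hX : IsWienerIntegral P e W Φ X) (hκ : ∀ h, Continuous (κ h))
    (hℓ : ∀ h s x, ℓ h (Φ s x) = κ h s * inner ℝ (e h) x)
    (hsum : ∀ u, Summable fun h => ℓ h u ^ 2) (j : ℕ ≃ ι) :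
    Tendsto (fun M => ∏ n ∈ Finset.range M, (√(1 + 2 * ∫ s in Set.Icc 0 T, κ (j n) s ^ 2))⁻¹)
      atTop (𝓝 (∫ ω, Real.exp (-∑' h, ℓ h (X ω) ^ 2) ∂P)) := by
  have h1 : ∀ M, ∏ n ∈ Finset.range M, (√(1 + 2 * ∫ s in Set.Icc 0 T, κ (j n) s ^ 2))⁻¹ =
      ∫ ω, Real.exp (-∑ n ∈ Finset.range M, ℓ (j n) (X ω) ^ 2) ∂P := fun M => by
    have := hX.integral_exp_neg_sum_sq hW hκ hℓ ((Finset.range M).map j.toEmbedding)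
    simpa using this.symm
  simp only [h1]
  refine tendsto_integral_of_dominated_convergence (fun _ => 1) (fun M => ?_)
    (integrable_const _) (fun M => ?_) ?_
  · have hm : ∀ h, AEMeasurable (fun ω => ℓ h (X ω)) P := fun h =>
      (hX.hasLaw_coord hW hκ hℓ h).aemeasurable
    refine (Real.measurable_exp.comp_aemeasurable ?_).aestronglyMeasurable
    exact (Finset.aemeasurable_fun_sum _ fun n _ => (hm (j n)).pow_const 2).neg
  · refine Eventually.of_forall fun ω => ?_
    rw [Real.norm_eq_abs, Real.abs_exp, Real.exp_le_one_iff, neg_nonpos]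
    exact Finset.sum_nonneg fun n _ => sq_nonneg _
  · refine Eventually.of_forall fun ω => ?_
    have h2 : HasSum (fun n => ℓ (j n) (X ω) ^ 2) (∑' h, ℓ h (X ω) ^ 2) :=
      (Equiv.hasSum_iff j).2 (hsum (X ω)).hasSum
    exact (Real.continuous_exp.tendsto _).comp h2.tendsto_sum_nat.neg

end Joint

/-! ### Estimates for the infinite product -/

/-- Comparison of `x ^ (-q)` with the telescoping differences of `x ^ (1 - q)`. -/
theorem rpow_sub_rpow_add_one_bounds {q x : ℝ} (hq : 1 < q) (hx : 0 < x) :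
    (q - 1) * (x + 1) ^ (-q) ≤ x ^ (1 - q) - (x + 1) ^ (1 - q) ∧
      x ^ (1 - q) - (x + 1) ^ (1 - q) ≤ (q - 1) * x ^ (-q) := by
  have hd : ∀ y ∈ Set.Ioo x (x + 1),
      HasDerivAt (fun y : ℝ => y ^ (1 - q)) ((1 - q) * y ^ (1 - q - 1)) y := fun y hy =>
    Real.hasDerivAt_rpow_const (Or.inl (hx.trans hy.1).ne')
  have hc : ContinuousOn (fun y : ℝ => y ^ (1 - q)) (Set.Icc x (x + 1)) := fun y hy =>
    (Real.continuousAt_rpow_const _ _ (Or.inl (hx.trans_le hy.1).ne')).continuousWithinAt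
  obtain ⟨y, hy, h⟩ := exists_hasDerivAt_eq_slope _ _ (lt_add_one x) hc hd
  rw [add_sub_cancel_left, div_one, show 1 - q - 1 = -q by ring] at h
  have h1 : x ^ (1 - q) - (x + 1) ^ (1 - q) = (q - 1) * y ^ (-q) := by linarith
  rw [h1]
  have hq0 : -q ≤ 0 := by linarith
  have hq1 : 0 ≤ q - 1 := by linarith
  exact ⟨mul_le_mul_of_nonneg_left
      (Real.rpow_le_rpow_of_nonpos (hx.trans hy.1) hy.2.le hq0) hq1,
    mul_le_mul_of_nonneg_left (Real.rpow_le_rpow_of_nonpos hx hy.1.le hq0) hq1⟩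

theorem sum_rpow_neg_le {q : ℝ} (hq : 1 < q) (M : ℕ) :
    ∑ n ∈ Finset.range M, ((n : ℝ) + 1) ^ (-q) ≤ q / (q - 1) := by
  have hq1 : 0 < q - 1 := by linarith
  have key : ∀ M : ℕ, (q - 1) * ∑ n ∈ Finset.range (M + 1), ((n : ℝ) + 1) ^ (-q) ≤
      q - ((M : ℝ) + 1) ^ (1 - q) := by
    intro M
    induction M with
    | zero => simp
    | succ M ih =>
      rw [Finset.sum_range_succ, mul_add]
      have := (rpow_sub_rpow_add_one_bounds hq (show (0 : ℝ) < M + 1 by positivity)).1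
      push_cast
      linarith
  rw [le_div_iff₀ hq1, mul_comm]
  refine le_trans (mul_le_mul_of_nonneg_left (Finset.sum_le_sum_of_subset_of_nonneg
    (Finset.range_mono M.le_succ) fun n _ _ => by positivity) hq1.le) ((key M).trans ?_)
  have : (0 : ℝ) ≤ ((M : ℝ) + 1) ^ (1 - q) := by positivity
  linarith

theorem le_sum_Ico_rpow_neg {q : ℝ} (hq : 1 < q) {N M : ℕ} (hNM : N ≤ M) :
    ((N : ℝ) + 1) ^ (1 - q) - ((M : ℝ) + 1) ^ (1 - q) ≤
      (q - 1) * ∑ n ∈ Finset.Ico N M, ((n : ℝ) + 1) ^ (-q) := by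
  induction M, hNM using Nat.le_induction with
  | base => simp
  | succ M hM ih =>
    rw [Finset.sum_Ico_succ_top hM, mul_add]
    have := (rpow_sub_rpow_add_one_bounds hq (show (0 : ℝ) < M + 1 by positivity)).2
    push_cast
    linarith

theorem exp_neg_sum_le_prod (σ : ℕ → ℝ) (hσ : ∀ n, 0 ≤ σ n) (s : Finset ℕ) :
    Real.exp (-∑ n ∈ s, σ n) ≤ ∏ n ∈ s, (√(1 + 2 * σ n))⁻¹ := by
  rw [← Finset.sum_neg_distrib, Real.exp_sum]
  refine Finset.prod_le_prod (fun n _ => (Real.exp_pos _).le) fun n _ => ?_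
  have h0 := hσ n
  rw [Real.exp_neg]
  gcongr
  rw [Real.sqrt_le_left (Real.exp_pos _).le, ← Real.exp_nat_mul]
  have := Real.add_one_le_exp (2 * σ n)
  push_cast
  linarith

theorem mul_exp_neg_half_le_sqrt {S : ℝ} (hS : 0 ≤ S) :
    1 + S * Real.exp (-(S / 2)) ≤ √(1 + 2 * S) := by
  apply Real.le_sqrt_of_sq_le
  set E := Real.exp (-(S / 2)) with hE
  have hE0 : 0 < E := Real.exp_pos _
  have hE1 : E ≤ 1 := Real.exp_le_one_iff.2 (by linarith)
  -- `1 - exp (-y) ≥ y exp (-y)` for `y = S / 2`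
  have h1 : (S / 2 + 1) * E ≤ 1 := by
    have := mul_le_mul_of_nonneg_right (Real.add_one_le_exp (S / 2)) hE0.le
    rwa [hE, ← Real.exp_add, add_neg_cancel, Real.exp_zero] at this
  have h2 : S * E ^ 2 ≤ S * E := by
    refine mul_le_mul_of_nonneg_left ?_ hS
    nlinarith
  nlinarith [mul_le_mul_of_nonneg_left h1 hS, mul_le_mul_of_nonneg_left h2 hS]

theorem one_add_sum_le_prod_one_add {κ : Type*} (s : Finset κ) (f : κ → ℝ) (hf : ∀ k, 0 ≤ f k) :
    1 + ∑ k ∈ s, f k ≤ ∏ k ∈ s, (1 + f k) := by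
  classical
  induction s using Finset.induction_on with
  | empty => simp
  | insert a s ha ih =>
    rw [Finset.sum_insert ha, Finset.prod_insert ha]
    have h1 := Finset.sum_nonneg fun k (_ : k ∈ s) => hf k
    nlinarith [hf a, mul_le_mul_of_nonneg_left ih (hf a), mul_nonneg (hf a) h1]

/-- The difference equals `∏_{n < M} (1 + 2 σ n)^{-1/2} * (∏_{N ≤ n < M} (1 + 2 σ n)^{1/2} - 1)`.
The first factor is at least `exp (-∑ σ)` and the second at least `√(1 + 2 S) - 1`, with `S` the sum
of `σ` over `[N, M)`. -/
theorem mul_exp_le_prod_sub_prod (σ : ℕ → ℝ) (hσ : ∀ n, 0 ≤ σ n) {N M : ℕ} (hNM : N ≤ M) :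
    (∑ n ∈ Finset.Ico N M, σ n) * Real.exp (-(3 / 2 * ∑ n ∈ Finset.range M, σ n)) ≤
      ∏ n ∈ Finset.range N, (√(1 + 2 * σ n))⁻¹ - ∏ n ∈ Finset.range M, (√(1 + 2 * σ n))⁻¹ := by
  set S := ∑ n ∈ Finset.Ico N M, σ n with hS
  have hS0 : 0 ≤ S := Finset.sum_nonneg fun n _ => hσ n
  have hST : S ≤ ∑ n ∈ Finset.range M, σ n := by
    rw [← Finset.sum_range_add_sum_Ico _ hNM]
    exact le_add_of_nonneg_left (Finset.sum_nonneg fun n _ => hσ n)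
  have hpos : ∀ n, 0 < √(1 + 2 * σ n) := fun n => Real.sqrt_pos.2 (by have := hσ n; positivity)
  have h1 : √(1 + 2 * S) ≤ ∏ n ∈ Finset.Ico N M, √(1 + 2 * σ n) := by
    rw [← Real.sqrt_prod _ fun n _ => by have := hσ n; positivity]
    refine Real.sqrt_le_sqrt ?_
    rw [hS, Finset.mul_sum]
    exact one_add_sum_le_prod_one_add _ _ fun n => mul_nonneg zero_le_two (hσ n)
  have h2 : ∏ n ∈ Finset.range N, (√(1 + 2 * σ n))⁻¹ =
      (∏ n ∈ Finset.range M, (√(1 + 2 * σ n))⁻¹) * ∏ n ∈ Finset.Ico N M, √(1 + 2 * σ n) := by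
    rw [← Finset.prod_range_mul_prod_Ico _ hNM, mul_assoc, ← Finset.prod_mul_distrib,
      Finset.prod_eq_one (s := Finset.Ico N M) fun n _ => inv_mul_cancel₀ (hpos n).ne', mul_one]
  have h3 := exp_neg_sum_le_prod σ hσ (Finset.range M)
  rw [h2, ← mul_sub_one]
  have h4 := mul_exp_neg_half_le_sqrt hS0
  calc S * Real.exp (-(3 / 2 * ∑ n ∈ Finset.range M, σ n))
      ≤ S * (Real.exp (-∑ n ∈ Finset.range M, σ n) * Real.exp (-(S / 2))) := by
        rw [← Real.exp_add]
        gcongr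
        linarith
    _ = Real.exp (-∑ n ∈ Finset.range M, σ n) * (S * Real.exp (-(S / 2))) := by ring
    _ ≤ _ := by
        gcongr
        linarith

/-- Lower bound for the tail effect in the product `∏ (1 + 2 σ n)^{-1/2}` when `σ n` has order
`n ^ (-q)`. -/
theorem le_prod_sub_limit {σ : ℕ → ℝ} {q K m l : ℝ} (hq : 1 < q) (hK : 0 ≤ K) (hm : 0 ≤ m)
    (hup : ∀ n : ℕ, σ n ≤ K * ((n : ℝ) + 1) ^ (-q))
    (hlow : ∀ n : ℕ, m * K / 2 * ((n : ℝ) + 1) ^ (-q) ≤ σ n) {N : ℕ} (hN : 1 ≤ N)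
    (hl : Tendsto (fun M => ∏ n ∈ Finset.range M, (√(1 + 2 * σ n))⁻¹) atTop (𝓝 l)) :
    m * (K * 2 ^ (-q) * (N : ℝ) ^ (1 - q) / ((q - 1) * Real.exp (6 * q * K / (q - 1)))) ≤
      ∏ n ∈ Finset.range N, (√(1 + 2 * σ n))⁻¹ - l := by
  have hq1 : 0 < q - 1 := by linarith
  have hσ : ∀ n, 0 ≤ σ n := fun n => le_trans (by positivity) (hlow n)
  set E := Real.exp (-(6 * q * K / (q - 1))) with hE
  have hsum : ∀ M, ∑ n ∈ Finset.range M, σ n ≤ q * K / (q - 1) := fun M => by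
    calc ∑ n ∈ Finset.range M, σ n ≤ ∑ n ∈ Finset.range M, K * ((n : ℝ) + 1) ^ (-q) :=
          Finset.sum_le_sum fun n _ => hup n
      _ = K * ∑ n ∈ Finset.range M, ((n : ℝ) + 1) ^ (-q) := (Finset.mul_sum _ _ _).symm
      _ ≤ K * (q / (q - 1)) := mul_le_mul_of_nonneg_left (sum_rpow_neg_le hq M) hK
      _ = _ := by ring
  have hM : ∀ M ≥ N, m * K / 2 * ((((N : ℝ) + 1) ^ (1 - q) - ((M : ℝ) + 1) ^ (1 - q)) / (q - 1)) * E
      ≤ ∏ n ∈ Finset.range N, (√(1 + 2 * σ n))⁻¹ - ∏ n ∈ Finset.range M, (√(1 + 2 * σ n))⁻¹ := by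
    intro M hNM
    refine le_trans ?_ (mul_exp_le_prod_sub_prod σ hσ hNM)
    have h1 : m * K / 2 * ((((N : ℝ) + 1) ^ (1 - q) - ((M : ℝ) + 1) ^ (1 - q)) / (q - 1)) ≤
        ∑ n ∈ Finset.Ico N M, σ n := by
      calc _ ≤ m * K / 2 * ∑ n ∈ Finset.Ico N M, ((n : ℝ) + 1) ^ (-q) := by
            refine mul_le_mul_of_nonneg_left ?_ (by positivity)
            rw [div_le_iff₀ hq1, mul_comm]
            exact le_sum_Ico_rpow_neg hq hNM
        _ ≤ _ := by
            rw [Finset.mul_sum]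
            exact Finset.sum_le_sum fun n _ => hlow n
    have h2 : E ≤ Real.exp (-(3 / 2 * ∑ n ∈ Finset.range M, σ n)) := by
      rw [hE, Real.exp_le_exp, neg_le_neg_iff]
      have h3 : 6 * q * K / (q - 1) = 6 * (q * K / (q - 1)) := by ring
      have h4 : 0 ≤ q * K / (q - 1) := by positivity
      linarith [hsum M]
    exact mul_le_mul h1 h2 (Real.exp_pos _).le (Finset.sum_nonneg fun n _ => hσ n)
  have hlim : Tendsto (fun M : ℕ => m * K / 2 *
      ((((N : ℝ) + 1) ^ (1 - q) - ((M : ℝ) + 1) ^ (1 - q)) / (q - 1)) * E) atTop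
      (𝓝 (m * K / 2 * ((((N : ℝ) + 1) ^ (1 - q) - 0) / (q - 1)) * E)) := by
    have h1 : Tendsto (fun M : ℕ => ((M : ℝ) + 1) ^ (1 - q)) atTop (𝓝 0) := by
      have := (tendsto_rpow_neg_atTop hq1).comp
        (tendsto_atTop_add_const_right _ (1 : ℝ) tendsto_natCast_atTop_atTop)
      simpa [Function.comp_def] using this
    exact (((h1.const_sub _).div_const _).const_mul _).mul_const _
  refine le_trans ?_ (le_of_tendsto_of_tendsto hlim (hl.const_sub _)
    (eventually_atTop.2 ⟨N, hM⟩))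
  have hN' : (1 : ℝ) ≤ N := by exact_mod_cast hN
  -- `N + 1 ≤ 2 N` turns the tail into a multiple of `N ^ (1 - q)`
  have h5 : 2 * 2 ^ (-q) * (N : ℝ) ^ (1 - q) ≤ ((N : ℝ) + 1) ^ (1 - q) := by
    have h6 : (2 : ℝ) * 2 ^ (-q) = 2 ^ (1 - q) := by
      rw [sub_eq_add_neg, Real.rpow_add two_pos, Real.rpow_one]
    rw [h6, ← Real.mul_rpow zero_le_two (by positivity)]
    exact Real.rpow_le_rpow_of_nonpos (by positivity) (by linarith) (by linarith)
  have h7 : m * (K * 2 ^ (-q) * (N : ℝ) ^ (1 - q) /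
      ((q - 1) * Real.exp (6 * q * K / (q - 1)))) =
      m * K / 2 * (2 * 2 ^ (-q) * (N : ℝ) ^ (1 - q) / (q - 1)) * E := by
    rw [hE, Real.exp_neg]
    field_simp
  rw [h7, sub_zero]
  gcongr

/-- The infimum is strictly above `-1`; its boundedness from below rules out the junk value. -/
theorem one_add_iInf_sin_div_pos {a : ℝ} (ha : 0 < a) (i : ℕ) :
    BddBelow (Set.range fun x : Set.Ici a => Real.sin x / ((-1) ^ i * (x : ℝ))) ∧
      0 < 1 + ⨅ x : Set.Ici a, Real.sin x / ((-1) ^ i * (x : ℝ)) := by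
  have habs : ∀ x : ℝ, 0 < x → |Real.sin x / ((-1) ^ i * x)| = |Real.sin x| / x := fun x hx => by
    rw [abs_div, abs_mul, abs_pow, abs_neg, abs_one, one_pow, one_mul, abs_of_pos hx]
  -- on `[a, a + 2]` compactness gives a bound below one, beyond it `|sin x / x| ≤ 1 / 2`
  obtain ⟨y, hy, hmax⟩ := isCompact_Icc.exists_isMaxOn
    (Set.nonempty_Icc.2 (le_add_of_nonneg_right zero_le_two : a ≤ a + 2))
    (f := fun x => |Real.sin x| / x)
    (fun x hx => (Real.continuous_sin.abs.continuousAt.div continuousAt_id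
      (ha.trans_le hx.1).ne').continuousWithinAt)
  have hy0 : 0 < y := ha.trans_le hy.1
  have hylt : |Real.sin y| / y < 1 := by
    rw [div_lt_one hy0]
    simpa [abs_of_pos hy0] using Real.abs_sin_lt_abs hy0.ne'
  set η := max (|Real.sin y| / y) (1 / 2) with hη
  have hη1 : η < 1 := max_lt hylt (by norm_num)
  have hb : ∀ x : Set.Ici a, -η ≤ Real.sin x / ((-1) ^ i * (x : ℝ)) := by
    rintro ⟨x, hx⟩
    have hx0 : 0 < x := ha.trans_le hx
    refine neg_le_of_abs_le ?_
    rw [habs x hx0]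
    rcases le_total x (a + 2) with h | h
    · exact le_max_of_le_left (hmax ⟨hx, h⟩)
    · refine le_max_of_le_right ?_
      rw [div_le_div_iff₀ hx0 two_pos]
      linarith [Real.abs_sin_le_one x]
  have : Nonempty (Set.Ici a) := ⟨⟨a, le_refl a⟩⟩
  refine ⟨⟨-η, by rintro _ ⟨x, rfl⟩; exact hb x⟩, ?_⟩
  linarith [le_ciInf hb]

/-! ### Smoothness of the test functions -/

-- The normed structure on `V →L[ℝ] V →L[ℝ] ℝ` is found only at a larger search depth.
set_option maxSynthPendingDepth 3 in
/-- Both derivatives are bounded because `x ^ k * exp (-x ^ 2) ≤ 1` for `x ≥ 0` and `k ≤ 2`. -/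
theorem isC2b_exp_neg_norm_sq {V E : Type*} [NormedAddCommGroup V] [NormedSpace ℝ V]
    [NormedAddCommGroup E] [InnerProductSpace ℝ E] (L : V →L[ℝ] E) :
    IsC2b fun v => Real.exp (-‖L v‖ ^ 2) := by
  set f : V → ℝ := fun v => Real.exp (-‖L v‖ ^ 2) with hf
  set M : V →L[ℝ] V →L[ℝ] ℝ :=
    (-2 : ℝ) • ((ContinuousLinearMap.compL ℝ V E ℝ).flip L).comp ((innerSL ℝ).comp L) with hM
  -- the gradient of `f` at `v` is `f v • M v`
  have hMapp : ∀ v w, M v w = -2 * inner ℝ (L v) (L w) := fun v w => rfl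
  have hd : ∀ v, HasFDerivAt f (f v • M v) v := by
    intro v
    refine ((L.hasFDerivAt (x := v)).norm_sq.neg.exp).congr_fderiv ?_
    ext w
    simp [hMapp, hf]
  have hfd : fderiv ℝ f = fun v => f v • M v := funext fun v => (hd v).fderiv
  have hd2 : ∀ v, HasFDerivAt (fun v => f v • M v) (f v • M + (f v • M v).smulRight (M v)) v :=
    fun v => (hd v).smul M.hasFDerivAt
  have hMn : ∀ v, ‖M v‖ ≤ 2 * ‖L‖ * ‖L v‖ := fun v => by
    refine ContinuousLinearMap.opNorm_le_bound _ (by positivity) fun w => ?_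
    rw [hMapp, norm_mul, norm_neg, Real.norm_two]
    calc 2 * ‖(inner ℝ (L v) (L w) : ℝ)‖ ≤ 2 * (‖L v‖ * (‖L‖ * ‖w‖)) := by
          gcongr
          exact (norm_inner_le_norm _ _).trans (by gcongr; exact L.le_opNorm w)
      _ = _ := by ring
  have hf0 : ∀ v, 0 ≤ f v := fun v => (Real.exp_pos _).le
  have hf1 : ∀ v, f v ≤ 1 := fun v => Real.exp_le_one_iff.2 (by simp)
  have hf2 : ∀ v, ‖L v‖ ^ 2 * f v ≤ 1 := fun v => by
    have h1 := mul_le_mul_of_nonneg_right (Real.add_one_le_exp (‖L v‖ ^ 2)) (hf0 v)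
    rw [← Real.exp_add, add_neg_cancel, Real.exp_zero] at h1
    linarith [hf0 v]
  have hf3 : ∀ v, ‖L v‖ * f v ≤ 1 := fun v => by
    nlinarith [hf2 v, hf1 v, hf0 v, mul_nonneg (hf0 v) (sq_nonneg (‖L v‖ - 1))]
  refine ⟨(L.contDiff.norm_sq ℝ).neg.exp, 1 + 2 * ‖L‖ + ‖M‖ + 4 * ‖L‖ ^ 2,
    fun v => ⟨?_, ?_, ?_⟩⟩
  · rw [Real.norm_eq_abs, abs_of_nonneg (hf0 v)]
    have : 0 ≤ 2 * ‖L‖ + ‖M‖ + 4 * ‖L‖ ^ 2 := by positivity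
    linarith [hf1 v]
  · rw [(hd v).fderiv, norm_smul, Real.norm_eq_abs, abs_of_nonneg (hf0 v)]
    have h1 : f v * ‖M v‖ ≤ 2 * ‖L‖ := by
      calc f v * ‖M v‖ ≤ f v * (2 * ‖L‖ * ‖L v‖) := mul_le_mul_of_nonneg_left (hMn v) (hf0 v)
        _ = 2 * ‖L‖ * (‖L v‖ * f v) := by ring
        _ ≤ 2 * ‖L‖ * 1 := mul_le_mul_of_nonneg_left (hf3 v) (by positivity)
        _ = _ := mul_one _
    have : 0 ≤ ‖M‖ + 4 * ‖L‖ ^ 2 := by positivity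
    linarith
  · rw [hfd, (hd2 v).fderiv]
    refine (norm_add_le (f v • M) ((f v • M v).smulRight (M v))).trans ?_
    rw [norm_smul (f v) M, ContinuousLinearMap.norm_smulRight_apply, norm_smul (f v) (M v),
      Real.norm_eq_abs, abs_of_nonneg (hf0 v)]
    have h1 : f v * ‖M‖ ≤ ‖M‖ := mul_le_of_le_one_left (norm_nonneg _) (hf1 v)
    have h2 : f v * ‖M v‖ * ‖M v‖ ≤ 4 * ‖L‖ ^ 2 := by
      calc f v * ‖M v‖ * ‖M v‖ = f v * ‖M v‖ ^ 2 := by ring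
        _ ≤ f v * (2 * ‖L‖ * ‖L v‖) ^ 2 :=
          mul_le_mul_of_nonneg_left (pow_le_pow_left₀ (norm_nonneg _) (hMn v) 2) (hf0 v)
        _ = 4 * ‖L‖ ^ 2 * (‖L v‖ ^ 2 * f v) := by ring
        _ ≤ 4 * ‖L‖ ^ 2 * 1 := mul_le_mul_of_nonneg_left (hf2 v) (by positivity)
        _ = _ := mul_one _
    have : 0 ≤ 2 * ‖L‖ := by positivity
    linarith

/-! ### Spectral coordinates of the stochastic wave equation -/

section Coordinates

variable {ι : Type*} (D : WaveData ι)

/-- The `h`-th coordinate of an element of `H_r` with respect to the orthonormal basis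
`|λ_h|^{-r} h` of `H_r`. -/
noncomputable def coordL (r : ℝ) (h : ι) : InterpSpace D r →L[ℝ] ℝ :=
  (lp.evalCLM ℝ (fun _ : ι => ℝ) 2 h).comp
    ((toL2ᵢ D r).toContinuousLinearEquiv : InterpSpace D r →L[ℝ] lp (fun _ : ι => ℝ) 2)

theorem coordL_apply (r : ℝ) (h : ι) (x : InterpSpace D r) :
    coordL D r h x = |D.lam h| ^ r * coeff D r x h := rfl

/-- The `h`-th orthonormal coordinate of the `i`-th component of an element of `𝐇_0`. -/
noncomputable def compCoord (i : ℕ) (h : ι) : BoldH D 0 →L[ℝ] ℝ :=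
  if i = 1 then (coordL D _ h).comp (WithLp.fstL 2 ℝ _ _)
  else (coordL D _ h).comp (WithLp.sndL 2 ℝ _ _)

theorem summable_compCoord_sq (i : ℕ) (u : BoldH D 0) :
    Summable fun h => compCoord D i h u ^ 2 := by
  unfold compCoord
  split_ifs
  · exact coeff_mem u.fst
  · exact coeff_mem u.snd

theorem testFun_eq (i : ℕ) (u : BoldH D 0) :
    testFun D i u = Real.exp (-∑' h, compCoord D i h u ^ 2) := by
  unfold compCoord testFun
  split_ifs
  · rw [norm_sq_interp]
    rfl
  · rw [norm_sq_interp]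
    rfl

theorem isC2b_testFun (i : ℕ) : IsC2b (testFun D i) := by
  unfold testFun
  split_ifs
  · exact isC2b_exp_neg_norm_sq (V := BoldH D 0) (E := InterpSpace D (0 / 2)) (WithLp.fstL 2 ℝ _ _)
  · exact isC2b_exp_neg_norm_sq (V := BoldH D 0) (E := InterpSpace D (0 / 2 - 1 / 2))
      (WithLp.sndL 2 ℝ _ _)

open scoped Classical in
/-- The integrand which drives the coordinate `compCoord D i h` of `𝐗^I`. -/
noncomputable def coordKernel (T : ℝ) (I : Set ι) (i : ℕ) (h : ι) (s : ℝ) : ℝ :=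
  if h ∈ I then D.mu h / |D.lam h| ^ (1 / 2 : ℝ) *
    (if i = 1 then Real.sin (|D.lam h| ^ (1 / 2 : ℝ) * (T - s))
      else Real.cos (|D.lam h| ^ (1 / 2 : ℝ) * (T - s)))
  else 0

theorem continuous_coordKernel (T : ℝ) (I : Set ι) (i : ℕ) (h : ι) :
    Continuous (coordKernel D T I i h) := by
  unfold coordKernel
  split_ifs <;> fun_prop

/-- In spectral coordinates the integrand `e^{(T-s)𝐀} 𝐏_I 𝐁` is diagonal. -/
theorem compCoord_integrand {H : Type*} [NormedAddCommGroup H] [InnerProductSpace ℝ H]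
    (b : HilbertBasis ι ℝ H) (T : ℝ) (I : Set ι) (i : ℕ) (h : ι) (s : ℝ) (x : H) :
    compCoord D i h
        (((waveGroup D (T - s)).comp ((boldP D 0 I).comp (boldB D b))) x) =
      coordKernel D T I i h s * inner ℝ (b h) x := by
  classical
  have hω := (freq_pos D h).ne'
  have h1 := coeff_boldP D 0 I (boldB D b x) h
  rw [(coeff_boldB D b x h).1, (coeff_boldB D b x h).2, ite_self] at h1
  have hw : |D.lam h| ^ ((0 : ℝ) / 2 - 1 / 2) = (|D.lam h| ^ (1 / 2 : ℝ))⁻¹ := by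
    rw [← Real.rpow_neg (abs_nonneg _)]
    norm_num
  have h2 : ∀ y, WithLp.fstL 2 ℝ (InterpSpace D (0 / 2)) (InterpSpace D (0 / 2 - 1 / 2)) y = y.fst :=
    fun y => rfl
  have h3 : ∀ y, WithLp.sndL 2 ℝ (InterpSpace D (0 / 2)) (InterpSpace D (0 / 2 - 1 / 2)) y = y.snd :=
    fun y => rfl
  unfold compCoord coordKernel
  by_cases hi : i = 1
  · simp only [hi, if_true, ContinuousLinearMap.comp_apply, h2, coordL_apply, coeff_waveGroup_fst,
      h1.1, h1.2]
    split_ifs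
    · simp
      ring
    · simp
  · simp only [hi, if_false, ContinuousLinearMap.comp_apply, h3, coordL_apply, coeff_waveGroup_snd,
      h1.1, h1.2, hw]
    split_ifs
    · field_simp
      ring
    · simp

/-- The variance of the coordinate `compCoord D i h` of `𝐗^I` for `h ∈ I`. -/
noncomputable def coordVar (T : ℝ) (i : ℕ) (h : ι) : ℝ :=
  D.mu h ^ 2 / |D.lam h| * (T / 2) *
    (1 + Real.sin (2 * |D.lam h| ^ (1 / 2 : ℝ) * T) /
      ((-1) ^ i * (2 * |D.lam h| ^ (1 / 2 : ℝ) * T)))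

open scoped Classical in
theorem integral_coordKernel_sq {T : ℝ} (hT : 0 < T) (I : Set ι) {i : ℕ} (hi : i = 1 ∨ i = 2)
    (h : ι) :
    ∫ s in Set.Icc 0 T, coordKernel D T I i h s ^ 2 = if h ∈ I then coordVar D T i h else 0 := by
  have hω := freq_pos D h
  have hsq : |D.lam h| ^ (1 / 2 : ℝ) * |D.lam h| ^ (1 / 2 : ℝ) = |D.lam h| := by
    rw [freq_sq, abs_of_neg (D.lam_neg h)]
  unfold coordKernel coordVar
  set w := |D.lam h| ^ (1 / 2 : ℝ)
  rw [← hsq]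
  split_ifs with hI hi1
  · subst hi1
    simp only [mul_pow]
    rw [integral_const_mul, integral_Icc_eq_integral_Ioc,
      ← intervalIntegral.integral_of_le hT.le,
      intervalIntegral.integral_comp_sub_left (fun s => Real.sin (w * s) ^ 2) T,
      intervalIntegral.integral_comp_mul_left (fun s => Real.sin s ^ 2) hω.ne', integral_sin_sq,
      mul_assoc 2 w T, Real.sin_two_mul]
    simp
    field_simp
    ring
  · obtain rfl : i = 2 := hi.resolve_left hi1
    simp only [mul_pow]
    rw [integral_const_mul, integral_Icc_eq_integral_Ioc,
      ← intervalIntegral.integral_of_le hT.le,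
      intervalIntegral.integral_comp_sub_left (fun s => Real.cos (w * s) ^ 2) T,
      intervalIntegral.integral_comp_mul_left (fun s => Real.cos s ^ 2) hω.ne', integral_cos_sq,
      mul_assoc 2 w T, Real.sin_two_mul]
    simp
    field_simp
    ring
  · simp

open scoped Classical in
/-- `𝔼[φ_i(𝐗^I)] = ∏_{h ∈ I} (1 + 2 Var)^{-1/2}`, as a limit of finite products along an
enumeration of the orthonormal basis. -/
theorem IsGalerkinSolution.tendsto_prod {Ω : Type*} {mΩ : MeasurableSpace Ω} {P : Measure Ω}
    [IsProbabilityMeasure P] {H : Type*} [NormedAddCommGroup H] [InnerProductSpace ℝ H]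
    {T : ℝ} {hT : 0 < T} {F : Filtration (Set.Icc (0 : ℝ) T) mΩ}
    {W : Set.Icc (0 : ℝ) T → H → Ω → ℝ} (hW : IsCylindricalWiener F hT P W)
    {D : WaveData ι} {b : HilbertBasis ι ℝ H} {I : Set ι} {X : Ω → BoldH D 0}
    (hX : IsGalerkinSolution P D b W I X) {i : ℕ} (hi : i = 1 ∨ i = 2) (j : ℕ ≃ ι) :
    Tendsto (fun M => ∏ n ∈ Finset.range M,
      (√(1 + 2 * if j n ∈ I then coordVar D T i (j n) else 0))⁻¹) atTop
      (𝓝 (∫ ω, testFun D i (X ω) ∂P)) := by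
  have := IsWienerIntegral.tendsto_prod hW hX (fun h => continuous_coordKernel D T I i h)
    (fun h s x => compCoord_integrand D b T I i h s x) (summable_compCoord_sq D i) j
  simpa only [integral_coordKernel_sq D hT I hi, ← testFun_eq] using this

end Coordinates
end StochWave

theorem corollary2p9
    {Ω : Type*} {mΩ : MeasurableSpace Ω} (P : Measure Ω) [IsProbabilityMeasure P]
    {H : Type*} [NormedAddCommGroup H] [InnerProductSpace ℝ H] [CompleteSpace H]
    {T : ℝ} (hT : 0 < T)
    (F : Filtration (Set.Icc (0 : ℝ) T) mΩ) (hF : IsNormalFiltration F hT P)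
    (W : Set.Icc (0 : ℝ) T → H → Ω → ℝ) (hW : IsCylindricalWiener F hT P W)
    {ι : Type*} (b : HilbertBasis ι ℝ H) (D : WaveData ι)
    (X : Set ι → Ω → BoldH D 0) (hX : ∀ I, IsGalerkinSolution P D b W I (X I))
    (c p δ : ℝ) (hc : 0 < c) (hp : 0 < p) (hδ : δ < 1 / 2 - 1 / (2 * p))
    (e : ℕ+ ≃ ι) (hlam : ∀ n : ℕ+, D.lam (e n) = -c * ((n : ℕ) : ℝ) ^ p)
    (hmu : ∀ h, |D.mu h| = |D.lam h| ^ δ)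
    (i : ℕ) (hi : i = 1 ∨ i = 2) :
    IsC2b (testFun D i) ∧
    ∀ N : ℕ+,
      (1 + ⨅ x : Set.Ici (2 * c ^ (1 / 2 : ℝ) * T), Real.sin x / ((-1) ^ i * (x : ℝ))) *
          (T * c ^ (2 * δ - 1) * 2 ^ (p * (2 * δ - 1)) *
              ((N : ℕ) : ℝ) ^ (p * (2 * δ - 1) + 1) /
            ((p * (1 - 2 * δ) - 1) *
              Real.exp (6 * p * (2 * δ - 1) * T * c ^ (2 * δ - 1) / (p * (2 * δ - 1) + 1)))) ≤
        (∫ ω, testFun D i (X (e '' {n | n ≤ N}) ω) ∂P) - ∫ ω, testFun D i (X Set.univ ω) ∂P ∧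
      0 < (1 + ⨅ x : Set.Ici (2 * c ^ (1 / 2 : ℝ) * T), Real.sin x / ((-1) ^ i * (x : ℝ))) *
          (T * c ^ (2 * δ - 1) * 2 ^ (p * (2 * δ - 1)) *
              ((N : ℕ) : ℝ) ^ (p * (2 * δ - 1) + 1) /
            ((p * (1 - 2 * δ) - 1) *
              Real.exp (6 * p * (2 * δ - 1) * T * c ^ (2 * δ - 1) / (p * (2 * δ - 1) + 1)))) := by
  classical
  refine ⟨isC2b_testFun D i, fun N => ?_⟩
  have ha : 0 < 2 * c ^ (1 / 2 : ℝ) * T := by positivity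
  obtain ⟨hbdd, hmpos⟩ := one_add_iInf_sin_div_pos ha i
  set m := 1 + ⨅ x : Set.Ici (2 * c ^ (1 / 2 : ℝ) * T), Real.sin x / ((-1) ^ i * (x : ℝ)) with hm
  set q := p * (1 - 2 * δ) with hqdef
  set K := T * c ^ (2 * δ - 1) with hKdef
  have hK : 0 < K := by positivity
  have hq : 1 < q := by
    have h1 : p * (1 / (2 * p)) = 1 / 2 := by field_simp
    nlinarith [mul_lt_mul_of_pos_left hδ hp]
  have hq1 : 0 < q - 1 := by linarith
  rw [show p * (2 * δ - 1) = -q by rw [hqdef]; ring,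
    show 6 * p * (2 * δ - 1) * T * c ^ (2 * δ - 1) / (-q + 1) = 6 * q * K / (q - 1) by
      rw [show -q + 1 = -(q - 1) by ring, div_neg, ← neg_div, hqdef, hKdef]; ring,
    show -q + 1 = 1 - q by ring]
  have hNpos : (0 : ℝ) < (N : ℕ) := by exact_mod_cast N.pos
  refine ⟨?_, by positivity⟩
  set j : ℕ ≃ ι := Equiv.pnatEquivNat.symm.trans e with hj
  have hjn : ∀ n, j n = e n.succPNat := fun n => rfl
  have habs : ∀ n : ℕ, |D.lam (j n)| = c * ((n : ℝ) + 1) ^ p := fun n => by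
    rw [hjn, hlam, Nat.succPNat_coe, neg_mul, abs_neg, abs_of_pos (by positivity)]
    push_cast
    rfl
  -- the variances are `K / 2 * n ^ (-q)`, up to the oscillating factor
  have hvar : ∀ n : ℕ, coordVar D T i (j n) = K / 2 * ((n : ℝ) + 1) ^ (-q) *
      (1 + Real.sin (2 * |D.lam (j n)| ^ (1 / 2 : ℝ) * T) /
        ((-1) ^ i * (2 * |D.lam (j n)| ^ (1 / 2 : ℝ) * T))) := fun n => by
    have h0 := D.abs_lam_pos (j n)
    have h1 : D.mu (j n) ^ 2 / |D.lam (j n)| = c ^ (2 * δ - 1) * ((n : ℝ) + 1) ^ (-q) := by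
      rw [← sq_abs, hmu, ← Real.rpow_natCast, ← Real.rpow_mul h0.le, ← Real.rpow_sub_one h0.ne',
        habs, Real.mul_rpow hc.le (by positivity), ← Real.rpow_mul (by positivity)]
      congr 2
      · push_cast; ring
      · rw [hqdef]; push_cast; ring
    rw [coordVar, h1, hKdef]
    ring
  have hfreq : ∀ n : ℕ, 2 * c ^ (1 / 2 : ℝ) * T ≤ 2 * |D.lam (j n)| ^ (1 / 2 : ℝ) * T := fun n => by
    have h1 : (1 : ℝ) ≤ ((n : ℝ) + 1) ^ p :=
      Real.one_le_rpow (le_add_of_nonneg_left n.cast_nonneg) hp.le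
    have h2 : c ≤ |D.lam (j n)| := by
      rw [habs]
      exact le_mul_of_one_le_right hc.le h1
    gcongr
  have hlow : ∀ n : ℕ, m * K / 2 * ((n : ℝ) + 1) ^ (-q) ≤ coordVar D T i (j n) := fun n => by
    have h1 := ciInf_le hbdd ⟨_, hfreq n⟩
    have h2 : 0 ≤ K / 2 * ((n : ℝ) + 1) ^ (-q) := by positivity
    rw [hvar]
    calc m * K / 2 * ((n : ℝ) + 1) ^ (-q) = K / 2 * ((n : ℝ) + 1) ^ (-q) * m := by ring
      _ ≤ _ := mul_le_mul_of_nonneg_left (add_le_add_right h1 1) h2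
  have hup : ∀ n : ℕ, coordVar D T i (j n) ≤ K * ((n : ℝ) + 1) ^ (-q) := fun n => by
    have hx := ha.trans_le (hfreq n)
    have h1 : Real.sin (2 * |D.lam (j n)| ^ (1 / 2 : ℝ) * T) /
        ((-1) ^ i * (2 * |D.lam (j n)| ^ (1 / 2 : ℝ) * T)) ≤ 1 := by
      refine (le_abs_self _).trans ?_
      rw [abs_div, abs_mul, abs_pow, abs_neg, abs_one, one_pow, one_mul]
      exact div_le_one_of_le₀ Real.abs_sin_le_abs (abs_nonneg _)
    have h2 : 0 ≤ K / 2 * ((n : ℝ) + 1) ^ (-q) := by positivity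
    rw [hvar]
    nlinarith [mul_le_mul_of_nonneg_left h1 h2]
  have hfull := (hX Set.univ).tendsto_prod hW hi j
  simp only [Set.mem_univ, if_true] at hfull
  have hmem : ∀ n, j n ∈ e '' {n | n ≤ N} ↔ n < (N : ℕ) := fun n => by
    rw [hjn, e.injective.mem_set_image, Set.mem_ofPred_eq, ← PNat.coe_le_coe, Nat.succPNat_coe,
      Nat.succ_le_iff]
  -- the products for `𝐗^{I_N}` are constant from `N` on
  have hfin : ∏ n ∈ Finset.range N, (√(1 + 2 * coordVar D T i (j n)))⁻¹ =
      ∫ ω, testFun D i (X (e '' {n | n ≤ N}) ω) ∂P := by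
    refine tendsto_nhds_unique (tendsto_const_nhds.congr' ?_)
      ((hX (e '' {n | n ≤ N})).tendsto_prod hW hi j)
    filter_upwards [eventually_ge_atTop (N : ℕ)] with M hM
    simp only [hmem]
    rw [← Finset.prod_subset (Finset.range_mono hM) fun n _ hn => by
      simp [Finset.mem_range.not.1 hn]]
    exact Finset.prod_congr rfl fun n hn => by simp [Finset.mem_range.1 hn]
  rw [← hfin]
  exact le_prod_sub_limit hq hK.le hmpos.le hup hlow N.pos hfull
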